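/- Let $E$ be a finite non-empty set and let $(J_t,S(t))_t$ be a Markov additive process with state space $E$, in discrete time ($t\in\mathbb N$) or continuous time ($t\in[0,\infty)$). That is, $(J,S)$ is adapted to a filtration $(\mathscr F_t)$, under $P_i$ one has $J_0=i$ and $S(0)=0$ almost surely, and for all $t,s\ge 0$, all bounded measurable $f$ and all $g:E\to\mathbb R$, $$E_i[f(S(t+s)-S(t))\,g(J_{t+s})\mid\mathscr F_t]=E_{J_t}[f(S(s))\,g(J_s)]\quad P_i\text{-a.s.}$$ $S(t)$ is the cumulative capacity and $\overline C(t)=S(t)/t$ ($t>0$) the transient capacity. Assume that $J$ is irreducible, with stationary distribution $\pi$. *Discrete time.* Let $\widehat F[\theta]=(E_i[e^{\theta S(1)};J_1=j])_{i,j\in E}$, let $\Theta$ be the set of real $\theta$ for which all entries are finite, and let $e^{\kappa(\theta)}$ be the Perron–Frobenius eigenvalue of $\widehat F[\theta]$ (the largest modulus of an eigenvalue). Let $h^{(\theta)}$ be the right eigenvector of $\widehat F[\theta]$ for $e^{\kappa(\theta)}$ with $\pi h^{(\theta)}=1$. *Continuous time.* The paths are càdlàg, $J$ has intensity matrix $\Lambda=(\lambda_{ij})$;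 while $J=i$, $S$ evolves as a Lévy process with drift $\mu_i$, volatility $\sigma_i\ge0$ and Lévy measure $\nu_i$ with $\int_{[-\epsilon,\epsilon]}|x|\,\nu_i(dx)<\infty$ and $\nu_i([-\epsilon,\epsilon]^c)<\infty$ for all $\epsilon>0$; and when $J$ jumps from $i$ to $j\ne i$, $S$ jumps with probability $q_{ij}$, the jump having law $B_{ij}$. (Precisely: for every $f:E\times\mathbb R\to\mathbb R$ that is $C^2$ in the second variable and bounded together with its first two derivatives, $f(J_t,S(t))-\int_0^t\mathcal A f(J_u,S(u))\,du$ is a martingale under each $P_i$, where $\mathcal A f(i,s)=\mu_i\partial_sf(i,s)+\tfrac{\sigma_i^2}2\partial_s^2f(i,s)+\int[f(i,s+x)-f(i,s)]\nu_i(dx)+\sum_{j\ne i}\lambda_{ij}\bigl[(1-q_{ij})f(j,s)+q_{ij}\int f(j,s+x)B_{ij}(dx)-f(i,s)\bigr]$.) Let $$K[\theta]=\Lambda+\mathrm{diag}(\kappa^{(i)}(\theta))+\bigl(\lambda_{ij}q_{ij}(\widehat B_{ij}[\theta]-1)\bigr)_{i\neq j},\qquad \kappa^{(i)}(\theta)=\theta\mu_i+\tfrac{\theta^2\sigma_i^2}2+\int(e^{\theta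 x}-1)\,\nu_i(dx),$$ where $\widehat B_{ij}[\theta]=\int e^{\theta x}B_{ij}(dx)$. Let $\Theta$ be the set of real $\theta$ for which these integrals are finite (those against $B_{ij}$ only where $\lambda_{ij}q_{ij}>0$), let $\kappa(\theta)$ be the eigenvalue of $K[\theta]$ with largest real part, and let $h^{(\theta)}$ be the right eigenvector of $K[\theta]$ for $\kappa(\theta)$ with $\pi h^{(\theta)}=1$. In both cases, for every $\theta\in\Theta$ the vector $h^{(\theta)}$ exists, is unique and has positive entries, and for every $\theta>0$, every initial state $J_0=i$ and every time $t$: (1) for every $x\in\mathbb R$, $$1-\frac{h_i^{(\theta)}e^{t\kappa(\theta)-\theta x}}{\min_{j\in E}h_j^{(\theta)}}\ \le\ P_i\{S(t)\le x\}\ \le\ \frac{h_i^{(-\theta)}e^{t\kappa(-\theta)+\theta x}}{\min_{j\in E}h_j^{(-\theta)}},$$ where the lower bound holds if $\theta\in\Theta$ and the upper bound if $-\theta\in\Theta$; (2) if $t>0$, then for all $y_l,y_u\in\mathbb R$, $$P_i\Bigl\{\overline C(t)\le\frac{t\kappa(\theta)+y_l}{\theta t}\Bigr\}\ \ge\ 1-\frac{h_i^{(\theta)}e^{-y_l}}{\min_{j\in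 E}h_j^{(\theta)}}\quad\text{if }\theta\in\Theta,$$ $$P_i\Bigl\{\overline C(t)\le\frac{t\kappa(-\theta)+y_u}{-\theta t}\Bigr\}\ \le\ \frac{h_i^{(-\theta)}e^{-y_u}}{\min_{j\in E}h_j^{(-\theta)}}\quad\text{if }-\theta\in\Theta.$$ -/

import Mathlib

open MeasureTheory ProbabilityTheory Filter Topology
open scoped NNReal

namespace MarkovAdditive

noncomputable section

/-- A Markov additive process `(J, S)` with finite state space `E`, on the filtered space
`(Ω, ℱ)`, for a time set `T` (here `ℕ` or `ℝ≥0`). `P i` is the law of the process started from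
`J 0 = i`, `S 0 = 0`. The last field is the defining identity
`E_i[f (S (t + s) - S t) g (J (t + s)) | ℱ t] = E_{J t}[f (S s) g (J s)]`. -/
structure IsMAP {T E Ω : Type*} [AddMonoid T] [Preorder T] [mΩ : MeasurableSpace Ω]
    (ℱ : Filtration T mΩ) (P : E → Measure Ω) (J : T → Ω → E) (S : T → Ω → ℝ) : Prop where
  prob : ∀ i, IsProbabilityMeasure (P i)
  adapted_J : ∀ t j, MeasurableSet[ℱ t] {ω | J t ω = j}
  adapted_S : ∀ t, Measurable[ℱ t] (S t)
  init : ∀ i, ∀ᵐ ω ∂(P i), J 0 ω = i ∧ S 0 ω = 0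
  markov_additive : ∀ (i : E) (t s : T) (f : ℝ → ℝ) (g : E → ℝ), Measurable f →
    (∃ C, ∀ x, |f x| ≤ C) →
    (P i)[fun ω => f (S (t + s) ω - S t ω) * g (J (t + s) ω) | ℱ t]
      =ᵐ[P i] fun ω => ∫ ω', f (S s ω') * g (J s ω') ∂(P (J t ω))

/-- The state graph with an edge `i → j` whenever `i ≠ j` and `M i j > 0` is strongly connected. -/
def IrreducibleChain {E : Type*} (M : Matrix E E ℝ) : Prop :=
  ∀ i j, Relation.ReflTransGen (fun a b => a ≠ b ∧ 0 < M a b) i j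

/-- The largest modulus of a complex eigenvalue. -/
def maxModulus {E : Type*} [Fintype E] [DecidableEq E] (M : Matrix E E ℝ) : ℝ :=
  sSup ((fun z : ℂ => ‖z‖) '' spectrum ℂ (M.map (fun a : ℝ => (a : ℂ))))

/-- The largest real part of a complex eigenvalue. -/
def maxRealPart {E : Type*} [Fintype E] [DecidableEq E] (M : Matrix E E ℝ) : ℝ :=
  sSup (Complex.re '' spectrum ℂ (M.map (fun a : ℝ => (a : ℂ))))

/-- `h` is a right eigenvector of `M` for the eigenvalue `r`, normalised by `π h = 1`. -/
def IsRightEigenvector {E : Type*} [Fintype E] (M : Matrix E E ℝ) (r : ℝ) (π h : E → ℝ) : Prop :=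
  M.mulVec h = r • h ∧ π ⬝ᵥ h = 1

/-- `min_j h j`. -/
def minEntry {E : Type*} [Fintype E] [Nonempty E] (h : E → ℝ) : ℝ :=
  Finset.univ.inf' Finset.univ_nonempty h

/-! ### Discrete time -/

section Discrete

variable {E Ω : Type*} [MeasurableSpace Ω]

/-- `p_{ij} = P_i(J_1 = j)`. -/
def transitionMatrix (P : E → Measure Ω) (J : ℕ → Ω → E) : Matrix E E ℝ :=
  Matrix.of fun i j => (P i).real {ω | J 1 ω = j}

/-- `F̂[θ]`, with entries `E_i[exp (θ S(1)); J_1 = j]`. -/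
def mgfMatrix (P : E → Measure Ω) (J : ℕ → Ω → E) (S : ℕ → Ω → ℝ) (θ : ℝ) : Matrix E E ℝ :=
  Matrix.of fun i j => ∫ ω in {ω | J 1 ω = j}, Real.exp (θ * S 1 ω) ∂(P i)

/-- The set `Θ` of real `θ` for which all entries of `F̂[θ]` are finite. -/
def mgfDomain (P : E → Measure Ω) (S : ℕ → Ω → ℝ) : Set ℝ :=
  {θ | ∀ i, Integrable (fun ω => Real.exp (θ * S 1 ω)) (P i)}

/-- `exp (κ(θ))` is the largest modulus of an eigenvalue of `F̂[θ]`. -/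
def discreteKappa [Fintype E] [DecidableEq E]
    (P : E → Measure Ω) (J : ℕ → Ω → E) (S : ℕ → Ω → ℝ) (θ : ℝ) : ℝ :=
  Real.log (maxModulus (mgfMatrix P J S θ))

/-- `h` is the right eigenvector `h^{(θ)}` of `F̂[θ]` for the eigenvalue `exp (κ(θ))`, normalised by
`π h = 1`. -/
def IsDiscreteH [Fintype E] [DecidableEq E] (P : E → Measure Ω) (J : ℕ → Ω → E)
    (S : ℕ → Ω → ℝ) (π : E → ℝ) (θ : ℝ) (h : E → ℝ) : Prop :=
  IsRightEigenvector (mgfMatrix P J S θ) (Real.exp (discreteKappa P J S θ)) π h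

/-- `π` is a stationary distribution of the transition matrix `M`. -/
def IsStationaryDiscrete [Fintype E] (M : Matrix E E ℝ) (π : E → ℝ) : Prop :=
  (∀ i, 0 ≤ π i) ∧ ∑ i, π i = 1 ∧ Matrix.vecMul π M = π

end Discrete

/-! ### Continuous time -/

/-- The characteristics of a continuous-time Markov additive process: the intensity matrix of `J`;
for each state `i` the drift `μ_i`, the volatility `σ_i` and the Lévy measure `ν_i` of the Lévy
process followed by `S` while `J = i`; and, for each `i ≠ j`, the probability `q_{ij}` that `S`
jumps when `J` jumps from `i` to `j`, with the distribution `B_{ij}` of that jump of `S`. -/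
structure Characteristics (E : Type*) [Fintype E] where
  rate : Matrix E E ℝ
  drift : E → ℝ
  vol : E → ℝ
  levy : E → Measure ℝ
  jumpProb : E → E → ℝ
  jumpLaw : E → E → Measure ℝ
  rate_nonneg : ∀ i j, i ≠ j → 0 ≤ rate i j
  rate_sum : ∀ i, ∑ j, rate i j = 0
  vol_nonneg : ∀ i, 0 ≤ vol i
  levy_zero : ∀ i, levy i {0} = 0
  levy_small : ∀ i, ∀ ε > 0, IntegrableOn (fun x : ℝ => |x|) (Set.Icc (-ε) ε) (levy i)
  levy_large : ∀ i, ∀ ε > 0, levy i (Set.Icc (-ε) ε)ᶜ < ⊤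
  jumpProb_mem : ∀ i j, jumpProb i j ∈ Set.Icc (0 : ℝ) 1
  jumpLaw_prob : ∀ i j, IsProbabilityMeasure (jumpLaw i j)

section Continuous

variable {E : Type*} [Fintype E] [DecidableEq E]

/-- The Lévy exponent `κ^{(i)}(θ)` of `S` in state `i`. -/
def Characteristics.exponent (D : Characteristics E) (i : E) (θ : ℝ) : ℝ :=
  θ * D.drift i + θ ^ 2 * D.vol i ^ 2 / 2 + ∫ x, (Real.exp (θ * x) - 1) ∂(D.levy i)

/-- `K[θ] = Λ + diag (κ^{(i)}(θ)) + (λ_{ij} q_{ij} (B̂_{ij}[θ] - 1))_{i ≠ j}`. -/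
def Characteristics.K (D : Characteristics E) (θ : ℝ) : Matrix E E ℝ :=
  Matrix.of fun i j => D.rate i j +
    if i = j then D.exponent i θ
    else D.rate i j * D.jumpProb i j * ((∫ x, Real.exp (θ * x) ∂(D.jumpLaw i j)) - 1)

/-- The set `Θ` of real `θ` for which all the integrals in `K[θ]` are finite (the integral against
`B_{ij}` is relevant only if jumps with this law do occur). -/
def Characteristics.domain (D : Characteristics E) : Set ℝ :=
  {θ | (∀ i, Integrable (fun x => Real.exp (θ * x) - 1) (D.levy i)) ∧
    ∀ i j, i ≠ j → 0 < D.rate i j * D.jumpProb i j →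
      Integrable (fun x => Real.exp (θ * x)) (D.jumpLaw i j)}

/-- `κ(θ)` is the largest real part of an eigenvalue of `K[θ]`. -/
def Characteristics.kappa (D : Characteristics E) (θ : ℝ) : ℝ := maxRealPart (D.K θ)

/-- `h` is the right eigenvector `h^{(θ)}` of `K[θ]` for the eigenvalue `κ(θ)`, normalised by
`π h = 1`. -/
def Characteristics.IsH (D : Characteristics E) (π : E → ℝ) (θ : ℝ) (h : E → ℝ) : Prop :=
  IsRightEigenvector (D.K θ) (D.kappa θ) π h

/-- `π` is a stationary distribution of the intensity matrix `Λ`. -/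
def IsStationaryContinuous (Λ : Matrix E E ℝ) (π : E → ℝ) : Prop :=
  (∀ i, 0 ≤ π i) ∧ ∑ i, π i = 1 ∧ Matrix.vecMul π Λ = 0

/-- The infinitesimal generator of `(J, S)`: between the jumps of `J`, the generator of the Lévy
process of the current state; at rate `λ_{ij}`, a jump of `J` from `i` to `j`, accompanied with
probability `q_{ij}` by a jump of `S` with law `B_{ij}`. -/
def Characteristics.generator (D : Characteristics E) (f : E → ℝ → ℝ) (i : E) (s : ℝ) : ℝ :=
  D.drift i * deriv (f i) s + D.vol i ^ 2 / 2 * iteratedDeriv 2 (f i) s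
    + ∫ x, (f i (s + x) - f i s) ∂(D.levy i)
    + ∑ j ∈ Finset.univ.erase i, D.rate i j *
        ((1 - D.jumpProb i j) * f j s
          + D.jumpProb i j * (∫ x, f j (s + x) ∂(D.jumpLaw i j)) - f i s)

/-- Test functions: twice continuously differentiable in `s`, bounded with the first two
derivatives. -/
def IsTestFunction (f : E → ℝ → ℝ) : Prop :=
  ∀ j, ContDiff ℝ 2 (f j) ∧
    ∃ C, ∀ s, |f j s| ≤ C ∧ |deriv (f j) s| ≤ C ∧ |iteratedDeriv 2 (f j) s| ≤ C

/-- `(J, S)` is a càdlàg continuous-time Markov additive process with characteristics `D`: it is a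
Markov additive process that solves the martingale problem for the generator given by `D`. -/
structure IsContinuousMAP {Ω : Type*} [mΩ : MeasurableSpace Ω] (D : Characteristics E)
    (ℱ : Filtration ℝ≥0 mΩ) (P : E → Measure Ω) (J : ℝ≥0 → Ω → E) (S : ℝ≥0 → Ω → ℝ) : Prop where
  isMAP : IsMAP ℱ P J S
  J_right : ∀ ω t, ∀ᶠ u in 𝓝[>] t, J u ω = J t ω
  J_left : ∀ ω t, ∃ j, ∀ᶠ u in 𝓝[<] t, J u ω = j
  S_right : ∀ ω t, Tendsto (fun u => S u ω) (𝓝[>] t) (𝓝 (S t ω))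
  S_left : ∀ ω t, ∃ l, Tendsto (fun u => S u ω) (𝓝[<] t) (𝓝 l)
  martingale : ∀ i f, IsTestFunction f →
    Martingale (fun (t : ℝ≥0) ω => f (J t ω) (S t ω)
      - ∫ u in (0 : ℝ)..t, D.generator f (J u.toNNReal ω) (S u.toNNReal ω)) ℱ (P i)

end Continuous

end

end MarkovAdditive

/-! Let `h` be a positive vector with F̂[θ]h = e^κ h (discrete time) or K[θ]h = κh (continuous
time). The process M(t) = exp(θS(t) - κt) h(J_t) then has no upward drift under P_i and starts at
h_i. On {θS(t) ≥ x} it is at least e^(x - κt) min h, so Markov's inequality suggests P_i{θS(t) ≥ x}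
≤ h_i e^(tκ - x) / min h. This tail bound at θ and at -θ gives the two halves of (1), and (2) is (1)
at the level x that cancels tκ.

The vector `h` comes from Perron–Frobenius theory: a maximiser of the Collatz–Wielandt ratio is a
positive eigenvector (`exists_pos_eigenvector`), a positive eigenvector is unique up to scale
(`eq_smul_of_eigenvector`), and its eigenvalue dominates the spectrum
(`norm_add_le_of_mem_spectrum`), so it is the one that defines κ(θ).

In discrete time the mean of M is controlled step by step, by truncation and Fatou's lemma
(`IsMAP.lintegral_exp_le`). In continuous time the martingale problem admits only bounded test
functions, which excludes M. It is replaced by y/(1+y) with y = e^b M, that is, by the sigmoid of b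
+ log M. This function is bounded and smooth, and concave in y, so the tangent inequality keeps its
drift nonpositive (`Characteristics.generator_sigmoid_le`, `IsContinuousMAP.integral_sigmoid_le`).
As b → -∞, y/(1+y) behaves like y and the sharp constant reappears (`IsContinuousMAP.tail`). -/

namespace MarkovAdditive

/-! ### Perron–Frobenius theory for irreducible matrices -/

section PerronFrobenius

variable {E : Type*} [Fintype E]

/-- A positive diagonal lets a path wait at a state, so an entry once positive stays positive in all
higher powers. The sum of connecting path lengths over all pairs therefore serves every pair at
once. -/
lemma exists_pow_pos [DecidableEq E] {A : Matrix E E ℝ} (hA : ∀ i j, 0 ≤ A i j) (hd : ∀ i, 0 < A i i)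
    (hirr : IrreducibleChain A) : ∃ N : ℕ, ∀ i j, 0 < (A ^ N) i j := by
  have hnn : ∀ N i j, 0 ≤ (A ^ N) i j := by
    intro N
    induction N with
    | zero =>
      intro i j
      rw [pow_zero, Matrix.one_apply]
      split_ifs <;> norm_num
    | succ n ih =>
      intro i j
      rw [pow_succ, Matrix.mul_apply]
      exact Finset.sum_nonneg fun k _ => mul_nonneg (ih i k) (hA k j)
  have step : ∀ N i k j, 0 < (A ^ N) i k → 0 < A k j → 0 < (A ^ (N + 1)) i j := by
    intro N i k j h1 h2
    rw [pow_succ, Matrix.mul_apply]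
    exact Finset.sum_pos' (fun k _ => mul_nonneg (hnn N i k) (hA k j))
      ⟨k, Finset.mem_univ _, mul_pos h1 h2⟩
  have mono : ∀ i j N M, N ≤ M → 0 < (A ^ N) i j → 0 < (A ^ M) i j := by
    intro i j N M hNM h
    induction M, hNM using Nat.le_induction with
    | base => exact h
    | succ M _ ih => exact step M i j j ih (hd j)
  have ex : ∀ i j, ∃ N : ℕ, 0 < (A ^ N) i j := by
    intro i j
    induction hirr i j with
    | refl => exact ⟨0, by simp⟩
    | tail _ h ih =>
      obtain ⟨N, hN⟩ := ih
      exact ⟨N + 1, step N i _ _ hN h.2⟩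
  choose n hn using ex
  refine ⟨∑ i, ∑ j, n i j, fun i j => mono i j (n i j) _ ?_ (hn i j)⟩
  calc n i j ≤ ∑ j, n i j :=
        Finset.single_le_sum (f := fun j => n i j) (fun _ _ => Nat.zero_le _) (Finset.mem_univ j)
    _ ≤ _ := Finset.single_le_sum (f := fun i => ∑ j, n i j) (fun _ _ => Nat.zero_le _)
        (Finset.mem_univ i)

lemma mulVec_pos {P : Matrix E E ℝ} (hP : ∀ i j, 0 < P i j) {z : E → ℝ} (hz : ∀ i, 0 ≤ z i)
    (hz0 : z ≠ 0) (i : E) : 0 < (P.mulVec z) i := by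
  obtain ⟨j, hj⟩ := Function.ne_iff.1 hz0
  exact Finset.sum_pos' (fun k _ => mul_nonneg (hP i k).le (hz k))
    ⟨j, Finset.mem_univ _, mul_pos (hP i j) (lt_of_le_of_ne (hz j) (Ne.symm hj))⟩

/-- A vector maximising the Collatz–Wielandt ratio. -/
lemma exists_maximal_ratio [DecidableEq E] [Nonempty E] {A : Matrix E E ℝ} (hA : ∀ i j, 0 ≤ A i j) :
    ∃ (x : E → ℝ) (r : ℝ), x ∈ stdSimplex ℝ E ∧ 0 ≤ r ∧ (∀ i, r * x i ≤ (A.mulVec x) i) ∧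
      ∀ y ∈ stdSimplex ℝ E, ∀ s, 0 ≤ s → (∀ i, s * y i ≤ (A.mulVec y) i) → s ≤ r := by
  have bound : ∀ y ∈ stdSimplex ℝ E, ∀ s, (∀ i, s * y i ≤ (A.mulVec y) i) →
      s ≤ ∑ i, ∑ j, A i j := by
    intro y hy s hs
    calc s = ∑ i, s * y i := by rw [← Finset.mul_sum, hy.2, mul_one]
      _ ≤ ∑ i, (A.mulVec y) i := Finset.sum_le_sum fun i _ => hs i
      _ ≤ _ := by
        refine Finset.sum_le_sum fun i _ => Finset.sum_le_sum fun j _ => ?_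
        have : y j ≤ 1 := by
          rw [← hy.2]
          exact Finset.single_le_sum (fun k _ => hy.1 k) (Finset.mem_univ j)
        exact mul_le_of_le_one_right (hA i j) this
  -- Carrying the ratio as a separate coordinate keeps the constraint closed; the minimum of (Ax)_i
  -- / x_i itself need not be continuous where entries of x vanish.
  set C : Set ((E → ℝ) × ℝ) := (stdSimplex ℝ E ×ˢ Set.Icc 0 (∑ i, ∑ j, A i j)) ∩
    {p | ∀ i, p.2 * p.1 i ≤ (A.mulVec p.1) i} with hC
  have hcomp : IsCompact C := by
    refine ((isCompact_stdSimplex ℝ E).prod isCompact_Icc).inter_right ?_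
    simp only [Set.ofPred_forall]
    refine isClosed_iInter fun i => isClosed_le (by fun_prop) ?_
    simp only [Matrix.mulVec, dotProduct]
    fun_prop
  have hne : C.Nonempty := by
    obtain ⟨i⟩ := ‹Nonempty E›
    refine ⟨(Pi.single i 1, 0), ⟨single_mem_stdSimplex ℝ i, le_rfl,
      Finset.sum_nonneg fun i _ => Finset.sum_nonneg fun j _ => hA i j⟩, fun k => ?_⟩
    simpa using hA k i
  obtain ⟨⟨x, r⟩, ⟨⟨hx, hr⟩, hxr⟩, hmax⟩ := hcomp.exists_isMaxOn hne continuous_snd.continuousOn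
  refine ⟨x, r, hx, hr.1, hxr, fun y hy s hs h => ?_⟩
  exact hmax (show (y, s) ∈ C from ⟨⟨hy, hs, bound y hy s h⟩, h⟩)

lemma exists_pos_eigenvector_of_nonneg [DecidableEq E] [Nonempty E] {A : Matrix E E ℝ} (hA : ∀ i j, 0 ≤ A i j)
    (hd : ∀ i, 0 < A i i) (hirr : IrreducibleChain A) :
    ∃ (r : ℝ) (h : E → ℝ), (∀ i, 0 < h i) ∧ A.mulVec h = r • h := by
  obtain ⟨N, hN⟩ := exists_pow_pos hA hd hirr
  obtain ⟨x, r, hx, hr, hxr, hmax⟩ := exists_maximal_ratio hA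
  have hx0 : x ≠ 0 := by
    rintro rfl
    simpa using hx.2
  have heq : A.mulVec x = r • x := by
    -- If Ax - rx were nonnegative but nonzero, applying the positive matrix A^N would make the
    -- slack strictly positive in every coordinate, so A^N x would have a ratio larger than r.
    by_contra hne
    have hz := mulVec_pos hN (z := A.mulVec x - r • x)
      (fun i => by simpa using hxr i) (sub_ne_zero.2 hne)
    set y := (A ^ N).mulVec x with hy
    have hypos : ∀ i, 0 < y i := mulVec_pos hN hx.1 hx0
    have hyz : ∀ i, 0 < (A.mulVec y) i - r * y i := by
      intro i
      have := hz i
      rw [Matrix.mulVec_sub, Matrix.mulVec_smul, Matrix.mulVec_mulVec, ← pow_succ, pow_succ',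
        ← Matrix.mulVec_mulVec, ← hy] at this
      simpa using this
    have hsum : 0 < ∑ i, y i := Finset.sum_pos (fun i _ => hypos i) Finset.univ_nonempty
    obtain ⟨i₀, -, hi₀⟩ := Finset.exists_min_image Finset.univ
      (fun i => (A.mulVec y) i - r * y i) Finset.univ_nonempty
    -- The least slack divided by ∑ y: since y_i ≤ ∑ y, adding δ y_i uses at most the slack of
    -- coordinate i.
    set δ := ((A.mulVec y) i₀ - r * y i₀) / ∑ i, y i with hδ
    have hδpos : 0 < δ := div_pos (hyz i₀) hsum
    have hle := hmax ((∑ i, y i)⁻¹ • y) ⟨fun i => mul_nonneg (inv_nonneg.2 hsum.le) (hypos i).le, by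
      simp only [Pi.smul_apply, smul_eq_mul]
      rw [← Finset.mul_sum, inv_mul_cancel₀ hsum.ne']⟩ (r + δ) (by positivity) (fun i => by
        rw [Matrix.mulVec_smul]
        simp only [Pi.smul_apply, smul_eq_mul]
        rw [mul_left_comm]
        refine mul_le_mul_of_nonneg_left ?_ (inv_nonneg.2 hsum.le)
        have h1 : y i ≤ ∑ i, y i :=
          Finset.single_le_sum (fun k _ => (hypos k).le) (Finset.mem_univ i)
        have h2 : δ * y i ≤ (A.mulVec y) i₀ - r * y i₀ := by
          rw [hδ, div_mul_eq_mul_div, div_le_iff₀ hsum]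
          exact mul_le_mul_of_nonneg_left h1 (hyz i₀).le
        have h3 := hi₀ i (Finset.mem_univ i)
        linarith)
    linarith
  refine ⟨r, x, fun i => ?_, heq⟩
  -- A^N x = r^N x is positive in every coordinate, hence so is x.
  have hpow : ∀ n : ℕ, (A ^ n).mulVec x = r ^ n • x := by
    intro n
    induction n with
    | zero => simp
    | succ n ih => rw [pow_succ, ← Matrix.mulVec_mulVec, heq, Matrix.mulVec_smul, ih, smul_smul,
        pow_succ, mul_comm]
  have := mulVec_pos hN hx.1 hx0 i
  rw [hpow] at this
  exact lt_of_le_of_ne (hx.1 i) fun h0 => by simp [← h0] at this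

/-- Perron–Frobenius theorem, existence of a positive eigenvector. -/
theorem exists_pos_eigenvector [DecidableEq E] [Nonempty E] {A : Matrix E E ℝ} (hA : ∀ i j, i ≠ j → 0 ≤ A i j)
    (hirr : IrreducibleChain A) :
    ∃ (r : ℝ) (h : E → ℝ), (∀ i, 0 < h i) ∧ A.mulVec h = r • h := by
  -- Adding c times the identity makes the diagonal positive; it preserves the eigenvectors and the
  -- off-diagonal graph.
  set c : ℝ := 1 + ∑ i, |A i i| with hc
  have hdiag : ∀ i, 0 < A i i + c := by
    intro i
    have h1 : |A i i| ≤ ∑ i, |A i i| :=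
      Finset.single_le_sum (f := fun i => |A i i|) (fun k _ => abs_nonneg _) (Finset.mem_univ i)
    have h2 := neg_abs_le (A i i)
    linarith
  have hoff : ∀ i j, i ≠ j → (A + c • (1 : Matrix E E ℝ)) i j = A i j := by
    intro i j hij
    simp [Matrix.one_apply_ne hij]
  obtain ⟨r, h, hpos, hr⟩ := exists_pos_eigenvector_of_nonneg (A := A + c • (1 : Matrix E E ℝ))
    (fun i j => by
      by_cases hij : i = j
      · subst hij
        simpa using (hdiag i).le
      · rw [hoff i j hij]
        exact hA i j hij)
    (fun i => by simpa using hdiag i)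
    (fun i j => Relation.ReflTransGen.mono
      (fun a b (hab : a ≠ b ∧ 0 < A a b) => ⟨hab.1, by rw [hoff a b hab.1]; exact hab.2⟩) _ _ (hirr i j))
  refine ⟨r - c, h, hpos, ?_⟩
  rw [Matrix.add_mulVec, Matrix.smul_mulVec, Matrix.one_mulVec] at hr
  rw [sub_smul, ← hr, add_sub_cancel_right]

/-- Perron–Frobenius theorem, simplicity of the eigenvalue with a positive eigenvector. -/
theorem eq_smul_of_eigenvector [Nonempty E] {A : Matrix E E ℝ} (hA : ∀ i j, i ≠ j → 0 ≤ A i j)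
    (hirr : IrreducibleChain A) {r : ℝ} {h y : E → ℝ} (hpos : ∀ i, 0 < h i)
    (hh : A.mulVec h = r • h) (hy : A.mulVec y = r • y) : ∃ c : ℝ, y = c • h := by
  -- Subtract the largest multiple of h that leaves y - c h nonnegative. The difference vanishes at
  -- i₀, and its eigenvector equation at a zero forces zeros at all successors, so irreducibility
  -- spreads them everywhere.
  obtain ⟨i₀, -, hi₀⟩ := Finset.exists_min_image Finset.univ (fun i => y i / h i)
    Finset.univ_nonempty
  refine ⟨y i₀ / h i₀, ?_⟩
  set c := y i₀ / h i₀ with hc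
  set w := y - c • h with hw
  have hw0 : ∀ i, 0 ≤ w i := by
    intro i
    have := hi₀ i (Finset.mem_univ i)
    rw [le_div_iff₀ (hpos i)] at this
    simpa [hw] using this
  have hAw : A.mulVec w = r • w := by
    rw [hw, Matrix.mulVec_sub, Matrix.mulVec_smul, hh, hy, smul_sub, smul_comm]
  have hzero : ∀ j, w j = 0 := by
    intro j
    induction hirr i₀ j with
    | refl => simp [hw, hc, div_mul_cancel₀ _ (hpos i₀).ne']
    | @tail a b _ hab ih =>
      have h1 : ∑ j, A a j * w j = 0 := by
        have := congrFun hAw a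
        simpa [ih, Matrix.mulVec, dotProduct] using this
      have h2 : ∀ j ∈ Finset.univ, 0 ≤ A a j * w j := by
        intro j _
        by_cases haj : a = j
        · rw [← haj, ih, mul_zero]
        · exact mul_nonneg (hA a j haj) (hw0 j)
      have := (Finset.sum_eq_zero_iff_of_nonneg h2).1 h1 b (Finset.mem_univ b)
      exact (mul_eq_zero.1 this).resolve_left hab.2.ne'
  exact sub_eq_zero.1 (funext hzero)

/-- B = A + cI is nonnegative with Bh = (r + c)h, so it has norm at most r + c for the maximum norm
weighted by 1/h. The estimate is read off where |v_i| / h_i is largest. Taking c = 0 bounds moduli;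
a large c bounds real parts, through Re z + c ≤ |z + c|. -/
lemma norm_add_le_of_mem_spectrum [DecidableEq E] [Nonempty E] {A : Matrix E E ℝ} {c : ℝ}
    (hA : ∀ i j, i ≠ j → 0 ≤ A i j) (hc : ∀ i, 0 ≤ A i i + c) {r : ℝ} {h : E → ℝ}
    (hpos : ∀ i, 0 < h i) (hh : A.mulVec h = r • h) {z : ℂ}
    (hz : z ∈ spectrum ℂ (A.map (fun a : ℝ => (a : ℂ)))) : ‖z + c‖ ≤ r + c := by
  rw [← Matrix.spectrum_toLin', ← Module.End.hasEigenvalue_iff_mem_spectrum] at hz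
  obtain ⟨v, hv⟩ := hz.exists_hasEigenvector
  have hv0 := hv.2
  have hv1 : (A.map (fun a : ℝ => (a : ℂ))).mulVec v = z • v := by
    simpa using hv.apply_eq_smul
  obtain ⟨i, -, hi⟩ := Finset.exists_max_image Finset.univ (fun i => ‖v i‖ / h i)
    Finset.univ_nonempty
  have hvj : ∀ j, ‖v j‖ ≤ ‖v i‖ / h i * h j := fun j =>
    (div_le_iff₀ (hpos j)).1 (hi j (Finset.mem_univ j))
  have hvi : 0 < ‖v i‖ := by
    refine lt_of_le_of_ne (norm_nonneg _) fun h0 => hv0 ?_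
    funext j
    have := hvj j
    rw [← h0, zero_div, zero_mul] at this
    exact norm_le_zero_iff.1 this
  set B : Matrix E E ℝ := A + c • (1 : Matrix E E ℝ) with hB
  have hBnn : ∀ i j, 0 ≤ B i j := by
    intro i j
    by_cases hij : i = j
    · subst hij
      simpa [hB] using hc i
    · simpa [hB, Matrix.one_apply_ne hij] using hA i j hij
  have h1 : (z + c) * v i = ∑ j, (B i j : ℂ) * v j := by
    have := congrFun hv1 i
    simp only [Matrix.mulVec, dotProduct, Matrix.map_apply, Pi.smul_apply, smul_eq_mul] at this
    rw [add_mul, ← this]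
    simp [hB, Matrix.one_apply, add_mul, Finset.sum_add_distrib, apply_ite Complex.ofReal]
  have h2 : ∑ j, B i j * h j = (r + c) * h i := by
    have := congrFun hh i
    simp only [Matrix.mulVec, dotProduct, Pi.smul_apply, smul_eq_mul] at this
    rw [add_mul, ← this]
    simp [hB, Matrix.one_apply, add_mul, Finset.sum_add_distrib]
  refine le_of_mul_le_mul_right ?_ hvi
  calc ‖z + c‖ * ‖v i‖ = ‖∑ j, (B i j : ℂ) * v j‖ := by rw [← norm_mul, h1]
    _ ≤ ∑ j, ‖(B i j : ℂ) * v j‖ := norm_sum_le _ _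
    _ ≤ ∑ j, B i j * (‖v i‖ / h i * h j) := by
      refine Finset.sum_le_sum fun j _ => ?_
      rw [norm_mul, Complex.norm_real, Real.norm_of_nonneg (hBnn i j)]
      exact mul_le_mul_of_nonneg_left (hvj j) (hBnn i j)
    _ = ‖v i‖ / h i * ∑ j, B i j * h j := by
      rw [Finset.mul_sum]
      exact Finset.sum_congr rfl fun j _ => by ring
    _ = (r + c) * ‖v i‖ := by
      rw [h2]
      field_simp [(hpos i).ne']

lemma mem_spectrum_of_eigenvector [DecidableEq E] [Nonempty E] {A : Matrix E E ℝ} {r : ℝ} {h : E → ℝ}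
    (hpos : ∀ i, 0 < h i) (hh : A.mulVec h = r • h) :
    (r : ℂ) ∈ spectrum ℂ (A.map (fun a : ℝ => (a : ℂ))) := by
  rw [← Matrix.spectrum_toLin', ← Module.End.hasEigenvalue_iff_mem_spectrum]
  refine Module.End.hasEigenvalue_of_hasEigenvector (x := fun i => (h i : ℂ)) ⟨?_, fun h0 => ?_⟩
  · rw [Module.End.mem_eigenspace_iff]
    funext i
    have := congrArg (fun a : ℝ => (a : ℂ)) (congrFun hh i)
    simpa [Matrix.mulVec, dotProduct] using this
  · obtain ⟨i⟩ := ‹Nonempty E›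
    have := congrFun h0 i
    simp [(hpos i).ne'] at this

lemma maxModulus_eq [DecidableEq E] [Nonempty E] {A : Matrix E E ℝ} (hA : ∀ i j, 0 ≤ A i j) {r : ℝ} {h : E → ℝ}
    (hr : 0 ≤ r) (hpos : ∀ i, 0 < h i) (hh : A.mulVec h = r • h) : maxModulus A = r := by
  refine IsGreatest.csSup_eq ⟨⟨r, mem_spectrum_of_eigenvector hpos hh, ?_⟩, ?_⟩
  · simp [abs_of_nonneg hr]
  · rintro _ ⟨z, hz, rfl⟩
    simpa using norm_add_le_of_mem_spectrum (c := 0) (fun i j _ => hA i j)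
      (fun i => by simpa using hA i i) hpos hh hz

lemma maxRealPart_eq [DecidableEq E] [Nonempty E] {A : Matrix E E ℝ} (hA : ∀ i j, i ≠ j → 0 ≤ A i j) {r : ℝ}
    {h : E → ℝ} (hpos : ∀ i, 0 < h i) (hh : A.mulVec h = r • h) : maxRealPart A = r := by
  refine IsGreatest.csSup_eq ⟨⟨r, mem_spectrum_of_eigenvector hpos hh, by simp⟩, ?_⟩
  rintro _ ⟨z, hz, rfl⟩
  have h1 := norm_add_le_of_mem_spectrum (c := ∑ i, |A i i|) hA (fun i => by
    have h1 : |A i i| ≤ ∑ i, |A i i| :=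
      Finset.single_le_sum (f := fun i => |A i i|) (fun k _ => abs_nonneg _) (Finset.mem_univ i)
    have h2 := neg_abs_le (A i i)
    linarith) hpos hh hz
  have h2 := (Complex.re_le_norm _).trans h1
  rw [Complex.add_re, Complex.ofReal_re] at h2
  linarith

/-- Existence, uniqueness and positivity of the normalised Perron–Frobenius eigenvector. -/
theorem isRightEigenvector_existsUnique_pos [Nonempty E] {A : Matrix E E ℝ}
    (hA : ∀ i j, i ≠ j → 0 ≤ A i j) (hirr : IrreducibleChain A) {r : ℝ} {h π : E → ℝ}
    (hpos : ∀ i, 0 < h i) (hh : A.mulVec h = r • h) (hπ : ∀ i, 0 ≤ π i) (hπ1 : ∑ i, π i = 1) :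
    (∃! g, IsRightEigenvector A r π g) ∧ ∀ g, IsRightEigenvector A r π g → ∀ j, 0 < g j := by
  have hdot : 0 < π ⬝ᵥ h := by
    obtain ⟨i, -, hi⟩ : ∃ i ∈ Finset.univ, π i ≠ 0 :=
      Finset.exists_ne_zero_of_sum_ne_zero (by rw [hπ1]; exact one_ne_zero)
    exact Finset.sum_pos' (fun k _ => mul_nonneg (hπ k) (hpos k).le)
      ⟨i, Finset.mem_univ i, mul_pos (lt_of_le_of_ne (hπ i) hi.symm) (hpos i)⟩
  have key : ∀ g, IsRightEigenvector A r π g → g = (π ⬝ᵥ h)⁻¹ • h := by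
    intro g hg
    obtain ⟨c, rfl⟩ := eq_smul_of_eigenvector hA hirr hpos hh hg.1
    have := hg.2
    rw [dotProduct_smul, smul_eq_mul] at this
    rw [eq_inv_of_mul_eq_one_left this]
  refine ⟨⟨(π ⬝ᵥ h)⁻¹ • h, ⟨?_, ?_⟩, key⟩, fun g hg j => ?_⟩
  · rw [Matrix.mulVec_smul, hh, smul_comm]
  · rw [dotProduct_smul, smul_eq_mul, inv_mul_cancel₀ hdot.ne']
  · rw [key g hg]
    exact mul_pos (inv_pos.2 hdot) (hpos j)

end PerronFrobenius

/-! ### From exponential tails to the bounds (1) and (2) -/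

section TailBounds

variable {Ω : Type*} [MeasurableSpace Ω]

/-- Intended for X = S(t), K = tκ, a = h_i, m = min h. The first claim passes to the complement; the
second is the first at level (K + y)/θ, where the exponent K - θx becomes -y. -/
lemma lower_bounds_of_tail {μ : Measure Ω} [IsProbabilityMeasure μ] {X : Ω → ℝ}
    (hX : Measurable X) {θ K a m : ℝ} (hθ : 0 < θ)
    (tail : ∀ x, μ.real {ω | x ≤ θ * X ω} ≤ a * Real.exp (K - x) / m) :
    (∀ x, 1 - a * Real.exp (K - θ * x) / m ≤ μ.real {ω | X ω ≤ x}) ∧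
      ∀ τ : ℝ, 0 < τ → ∀ y, 1 - a * Real.exp (-y) / m ≤
        μ.real {ω | X ω / τ ≤ (K + y) / (θ * τ)} := by
  have h1 : ∀ x, 1 - a * Real.exp (K - θ * x) / m ≤ μ.real {ω | X ω ≤ x} := by
    intro x
    have hc : μ.real {ω | X ω ≤ x}ᶜ = 1 - μ.real {ω | X ω ≤ x} :=
      probReal_compl_eq_one_sub (measurableSet_le hX measurable_const)
    have hle : μ.real {ω | X ω ≤ x}ᶜ ≤ μ.real {ω | θ * x ≤ θ * X ω} := by
      refine measureReal_mono fun ω hω => ?_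
      simp only [Set.mem_compl_iff, Set.mem_ofPred_eq, not_le] at hω ⊢
      exact mul_le_mul_of_nonneg_left hω.le hθ.le
    have := tail (θ * x)
    linarith
  refine ⟨h1, fun τ hτ y => ?_⟩
  have h2 := h1 ((K + y) / θ)
  rw [mul_div_cancel₀ _ hθ.ne', show K - (K + y) = -y by ring] at h2
  refine h2.trans (measureReal_mono fun ω hω => ?_)
  simp only [Set.mem_ofPred_eq] at hω ⊢
  rw [← div_div]
  exact div_le_div_of_nonneg_right hω hτ.le

lemma upper_bounds_of_tail {μ : Measure Ω} [IsFiniteMeasure μ] {X : Ω → ℝ} {θ K a m : ℝ}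
    (hθ : 0 < θ) (tail : ∀ x, μ.real {ω | x ≤ -θ * X ω} ≤ a * Real.exp (K - x) / m) :
    (∀ x, μ.real {ω | X ω ≤ x} ≤ a * Real.exp (K + θ * x) / m) ∧
      ∀ τ : ℝ, 0 < τ → ∀ y, μ.real {ω | X ω / τ ≤ (K + y) / (-θ * τ)} ≤
        a * Real.exp (-y) / m := by
  have h1 : ∀ x, μ.real {ω | X ω ≤ x} ≤ a * Real.exp (K + θ * x) / m := by
    intro x
    have h := tail (-θ * x)
    rw [show K - -θ * x = K + θ * x by ring] at h
    refine le_trans (measureReal_mono fun ω hω => ?_) h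
    simp only [Set.mem_ofPred_eq] at hω ⊢
    nlinarith
  refine ⟨h1, fun τ hτ y => ?_⟩
  have h2 := h1 ((K + y) / -θ)
  rw [show K + θ * ((K + y) / -θ) = -y by field_simp; ring] at h2
  refine le_trans (measureReal_mono fun ω hω => ?_) h2
  simp only [Set.mem_ofPred_eq] at hω ⊢
  rwa [← div_div, div_le_div_iff_of_pos_right hτ] at hω

end TailBounds

section MinEntry

variable {E : Type*} [Fintype E] [Nonempty E]

lemma minEntry_le (h : E → ℝ) (j : E) : minEntry h ≤ h j :=
  Finset.inf'_le _ (Finset.mem_univ j)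

lemma minEntry_pos {h : E → ℝ} (hpos : ∀ j, 0 < h j) : 0 < minEntry h :=
  (Finset.lt_inf'_iff _).2 fun j _ => hpos j

end MinEntry

/-- E carries no σ-algebra: measurability of J is only given fibre by fibre. -/
lemma measurable_comp_of_finite {E Ω : Type*} [Finite E] {m : MeasurableSpace Ω} {J : Ω → E}
    (hJ : ∀ j, MeasurableSet {ω | J ω = j}) {β : Type*} [MeasurableSpace β] (g : E → β) :
    Measurable fun ω => g (J ω) := by
  intro s _
  have : (fun ω => g (J ω)) ⁻¹' s = ⋃ j ∈ g ⁻¹' s, {ω | J ω = j} := by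
    ext ω
    simp
  rw [this]
  exact MeasurableSet.biUnion (Set.to_countable _) fun j _ => hJ j

/-! ### The Markov additive property in integrated form -/

section MAP

variable {T E Ω : Type*} [AddMonoid T] [Preorder T] [mΩ : MeasurableSpace Ω]
  {ℱ : Filtration T mΩ} {P : E → Measure Ω} {J : T → Ω → E} {S : T → Ω → ℝ}

lemma IsMAP.measurable_S (hM : IsMAP ℱ P J S) (t : T) : Measurable (S t) :=
  (hM.adapted_S t).mono (ℱ.le t) le_rfl

lemma IsMAP.measurable_J [Finite E] (hM : IsMAP ℱ P J S) (t : T) (g : E → ℝ) :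
    Measurable fun ω => g (J t ω) :=
  measurable_comp_of_finite (fun j => ℱ.le t _ (hM.adapted_J t j)) g

/-- The Markov additive property, integrated against a bounded `ℱ t`-measurable weight. -/
lemma IsMAP.integral_weight_mul [Fintype E] (hM : IsMAP ℱ P J S) (i : E) (t s : T) {f : ℝ → ℝ} (g : E → ℝ)
    (hf : Measurable f) (hfb : ∃ C, ∀ x, |f x| ≤ C) {W : Ω → ℝ} (hW : Measurable[ℱ t] W)
    (hWb : ∃ C, ∀ ω, |W ω| ≤ C) :
    ∫ ω, W ω * (f (S (t + s) ω - S t ω) * g (J (t + s) ω)) ∂(P i) =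
      ∫ ω, W ω * ∫ ω', f (S s ω') * g (J s ω') ∂(P (J t ω)) ∂(P i) := by
  have := hM.prob i
  obtain ⟨Cf, hCf⟩ := hfb
  obtain ⟨CW, hCW⟩ := hWb
  have hint : Integrable (fun ω => f (S (t + s) ω - S t ω) * g (J (t + s) ω)) (P i) := by
    refine Integrable.of_bound (C := Cf * ∑ j, |g j|) ?_ (ae_of_all _ fun ω => ?_)
    · exact ((hf.comp ((hM.measurable_S _).sub (hM.measurable_S _))).mul
        (hM.measurable_J _ g)).aestronglyMeasurable
    · rw [norm_mul]
      refine mul_le_mul (hCf _) ?_ (norm_nonneg _) ((abs_nonneg _).trans (hCf 0))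
      exact Finset.single_le_sum (f := fun j => |g j|) (fun _ _ => abs_nonneg _)
        (Finset.mem_univ _)
  have h1 := condExp_stronglyMeasurable_mul_of_bound (ℱ.le t) hW.stronglyMeasurable hint CW
    (ae_of_all _ hCW)
  have h2 := hM.markov_additive i t s f g hf ⟨Cf, hCf⟩
  rw [← integral_condExp (ℱ.le t)]
  refine integral_congr_ae ?_
  filter_upwards [h1, h2] with ω h1 h2
  rw [← h2]
  exact h1

end MAP

/-! ### Discrete time: exponential moments and tails -/

section Discrete

variable {E Ω : Type*} [mΩ : MeasurableSpace Ω]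
  {ℱ : Filtration ℕ mΩ} {P : E → Measure Ω} {J : ℕ → Ω → E} {S : ℕ → Ω → ℝ}

lemma mgfMatrix_nonneg (θ : ℝ) (i j : E) : 0 ≤ mgfMatrix P J S θ i j :=
  integral_nonneg fun _ => (Real.exp_pos _).le

lemma mgfMatrix_pos {θ : ℝ} (hθ : θ ∈ mgfDomain P S) {i j : E}
    (hij : 0 < transitionMatrix P J i j) : 0 < mgfMatrix P J S θ i j := by
  have hne : P i {ω | J 1 ω = j} ≠ 0 := fun h0 => by
    simp [transitionMatrix, measureReal_def, h0] at hij
  have : NeZero ((P i).restrict {ω | J 1 ω = j}) := ⟨by rwa [Ne, Measure.restrict_eq_zero]⟩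
  exact integral_exp_pos (hθ i).integrableOn

lemma IsMAP.sum_transitionMatrix [Fintype E] (hM : IsMAP ℱ P J S) (i : E) :
    ∑ j, transitionMatrix P J i j = 1 := by
  have := hM.prob i
  have h := measureReal_biUnion_finset (μ := P i) (s := Finset.univ)
    (f := fun j => {ω | J 1 ω = j})
    (fun a _ b _ hab => Set.disjoint_left.2 fun ω ha hb => hab (ha.symm.trans hb))
    (fun j _ => ℱ.le 1 _ (hM.adapted_J 1 j))
  have hu : (⋃ j ∈ (Finset.univ : Finset E), {ω | J 1 ω = j}) = Set.univ := by
    ext ω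
    simp
  rw [hu, probReal_univ] at h
  exact h.symm

lemma IsMAP.integral_exp_mul [Fintype E] (hM : IsMAP ℱ P J S) {θ : ℝ} (hθ : θ ∈ mgfDomain P S) (h : E → ℝ)
    (i : E) : Integrable (fun ω => Real.exp (θ * S 1 ω) * h (J 1 ω)) (P i) ∧
      ∫ ω, Real.exp (θ * S 1 ω) * h (J 1 ω) ∂(P i) = (mgfMatrix P J S θ).mulVec h i := by
  classical
  have hms : ∀ j, MeasurableSet {ω | J 1 ω = j} := fun j => ℱ.le 1 _ (hM.adapted_J 1 j)
  have heq : (fun ω => Real.exp (θ * S 1 ω) * h (J 1 ω)) = fun ω =>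
      ∑ j, {ω | J 1 ω = j}.indicator (fun ω => Real.exp (θ * S 1 ω)) ω * h j := by
    funext ω
    rw [Finset.sum_eq_single (J 1 ω)]
    · simp
    · intro j _ hj
      rw [Set.indicator_of_notMem (by simpa using hj.symm), zero_mul]
    · simp
  have hint : ∀ j ∈ Finset.univ, Integrable (fun ω =>
      {ω | J 1 ω = j}.indicator (fun ω => Real.exp (θ * S 1 ω)) ω * h j) (P i) :=
    fun j _ => ((hθ i).indicator (hms j)).mul_const _
  refine ⟨?_, ?_⟩
  · rw [heq]
    exact integrable_finsetSum _ hint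
  · rw [heq, integral_finsetSum _ hint]
    refine Finset.sum_congr rfl fun j _ => ?_
    rw [integral_mul_const, integral_indicator (hms j)]
    rfl

/-- `exp (θ S) h(J)` grows in mean at most by the factor `r` in each step. -/
lemma IsMAP.lintegral_exp_le [Fintype E] (hM : IsMAP ℱ P J S) {θ : ℝ} (hθ : θ ∈ mgfDomain P S)
    {r : ℝ} {h : E → ℝ} (hpos : ∀ j, 0 < h j) (hr : 0 < r)
    (hh : (mgfMatrix P J S θ).mulVec h = r • h) (i : E) (t : ℕ) :
    ∫⁻ ω, ENNReal.ofReal (Real.exp (θ * S t ω) * h (J t ω)) ∂(P i) ≤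
      ENNReal.ofReal (r ^ t * h i) := by
  have := hM.prob i
  induction t with
  | zero =>
    have : ∀ᵐ ω ∂(P i), ENNReal.ofReal (Real.exp (θ * S 0 ω) * h (J 0 ω)) =
        ENNReal.ofReal (h i) := by
      filter_upwards [hM.init i] with ω hω
      rw [hω.1, hω.2, mul_zero, Real.exp_zero, one_mul]
    rw [lintegral_congr_ae this]
    simp
  | succ t ih =>
    -- The Markov additive property covers bounded functions only, so the past exp(θ S_t) and the
    -- factor exp(θ(S_{t+1} - S_t)) are truncated separately at n.
    set W : ℕ → Ω → ℝ := fun n ω => min (Real.exp (θ * S t ω)) n with hW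
    set f : ℕ → ℝ → ℝ := fun n x => min (Real.exp (θ * x)) n with hf
    have hW0 : ∀ n ω, 0 ≤ W n ω := fun n ω => le_min (Real.exp_pos _).le n.cast_nonneg
    have hf0 : ∀ n x, 0 ≤ f n x := fun n x => le_min (Real.exp_pos _).le n.cast_nonneg
    have hWb : ∀ n ω, |W n ω| ≤ n := fun n ω => by
      rw [abs_of_nonneg (hW0 n ω)]
      exact min_le_right _ _
    have hfb : ∀ n x, |f n x| ≤ n := fun n x => by
      rw [abs_of_nonneg (hf0 n x)]
      exact min_le_right _ _
    have hfm : ∀ n, Measurable (f n) := fun n => by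
      simp only [hf]
      fun_prop
    have hWm : ∀ n, Measurable[ℱ t] (W n) := fun n =>
      (Real.measurable_exp.comp ((hM.adapted_S t).const_mul θ)).min measurable_const
    have hWm' : ∀ n, Measurable (W n) := fun n => (hWm n).mono (ℱ.le t) le_rfl
    have hhb : ∀ j, |h j| ≤ ∑ j, |h j| := fun j =>
      Finset.single_le_sum (f := fun j => |h j|) (fun _ _ => abs_nonneg _) (Finset.mem_univ j)
    have hWhint : ∀ n, Integrable (fun ω => W n ω * h (J t ω)) (P i) := fun n => by
      refine Integrable.of_bound (C := n * ∑ j, |h j|)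
        ((hWm' n).mul (hM.measurable_J t h)).aestronglyMeasurable (ae_of_all _ fun ω => ?_)
      rw [norm_mul]
      exact mul_le_mul (hWb n ω) (hhb _) (norm_nonneg _) n.cast_nonneg
    set F : ℕ → Ω → ℝ := fun n ω => W n ω * (f n (S (t + 1) ω - S t ω) * h (J (t + 1) ω)) with hF
    have hFm : ∀ n, Measurable (F n) := fun n => (hWm' n).mul (((hfm n).comp
      ((hM.measurable_S _).sub (hM.measurable_S _))).mul (hM.measurable_J _ h))
    have hF0 : ∀ n ω, 0 ≤ F n ω := fun n ω =>
      mul_nonneg (hW0 n ω) (mul_nonneg (hf0 n _) (hpos _).le)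
    have hFint : ∀ n, Integrable (F n) (P i) := fun n => by
      refine Integrable.of_bound (C := n * (n * ∑ j, |h j|)) (hFm n).aestronglyMeasurable
        (ae_of_all _ fun ω => ?_)
      rw [norm_mul, norm_mul]
      exact mul_le_mul (hWb n ω) (mul_le_mul (hfb n _) (hhb _) (norm_nonneg _) n.cast_nonneg)
        (by positivity) n.cast_nonneg
    -- Truncation only lowers the one-step mean, which is (F̂[θ]h)_j = r h_j without it.
    have hone : ∀ n j, ∫ ω', f n (S 1 ω') * h (J 1 ω') ∂(P j) ≤ r * h j := by
      intro n j
      obtain ⟨h1, h2⟩ := hM.integral_exp_mul hθ h j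
      rw [hh] at h2
      rw [show r * h j = (r • h) j from rfl, ← h2]
      refine integral_mono_of_nonneg (ae_of_all _ fun ω => mul_nonneg (hf0 n _) (hpos _).le) h1
        (ae_of_all _ fun ω => mul_le_mul_of_nonneg_right (min_le_left _ _) (hpos _).le)
    have hstep : ∀ n, ∫ ω, F n ω ∂(P i) ≤ r * ∫ ω, W n ω * h (J t ω) ∂(P i) := by
      intro n
      simp only [hF]
      rw [hM.integral_weight_mul i t 1 h (hfm n) ⟨n, hfb n⟩ (hWm n) ⟨n, hWb n⟩,
        ← integral_const_mul]
      refine integral_mono_of_nonneg (ae_of_all _ fun ω => mul_nonneg (hW0 n ω)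
        (integral_nonneg fun ω => mul_nonneg (hf0 n _) (hpos _).le)) ((hWhint n).const_mul r)
        (ae_of_all _ fun ω => ?_)
      calc _ ≤ W n ω * (r * h (J t ω)) := mul_le_mul_of_nonneg_left (hone n _) (hW0 n ω)
        _ = _ := by ring
    have hbound : ∀ n, ∫⁻ ω, ENNReal.ofReal (F n ω) ∂(P i) ≤
        ENNReal.ofReal (r ^ (t + 1) * h i) := by
      intro n
      rw [← ofReal_integral_eq_lintegral_ofReal (hFint n) (ae_of_all _ (hF0 n))]
      refine (ENNReal.ofReal_le_ofReal (hstep n)).trans ?_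
      rw [ENNReal.ofReal_mul hr.le, ofReal_integral_eq_lintegral_ofReal (hWhint n)
        (ae_of_all _ fun ω => mul_nonneg (hW0 n ω) (hpos _).le),
        pow_succ', mul_assoc, ENNReal.ofReal_mul hr.le]
      refine mul_le_mul_right ((lintegral_mono fun ω => ?_).trans ih) _
      exact ENNReal.ofReal_le_ofReal (mul_le_mul_of_nonneg_right (min_le_left _ _) (hpos _).le)
    -- For fixed ω both truncations are inactive once n is large, so Fatou's lemma recovers the
    -- untruncated mean.
    have hlim : ∀ ω, liminf (fun n => ENNReal.ofReal (F n ω)) atTop =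
        ENNReal.ofReal (Real.exp (θ * S (t + 1) ω) * h (J (t + 1) ω)) := by
      intro ω
      refine Tendsto.liminf_eq (tendsto_const_nhds.congr' ?_)
      filter_upwards [eventually_ge_atTop ⌈Real.exp (θ * S t ω)⌉₊,
        eventually_ge_atTop ⌈Real.exp (θ * (S (t + 1) ω - S t ω))⌉₊] with n h1 h2
      simp only [hF, hW, hf]
      rw [min_eq_left (Nat.ceil_le.1 h1), min_eq_left (Nat.ceil_le.1 h2), ← mul_assoc,
        ← Real.exp_add]
      congr 3
      ring
    calc _ = ∫⁻ ω, liminf (fun n => ENNReal.ofReal (F n ω)) atTop ∂(P i) := by simp only [hlim]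
      _ ≤ liminf (fun n => ∫⁻ ω, ENNReal.ofReal (F n ω) ∂(P i)) atTop :=
        lintegral_liminf_le fun n => (hFm n).ennreal_ofReal
      _ ≤ _ := liminf_le_of_frequently_le' (Frequently.of_forall hbound)

/-- Markov's inequality: on the event, exp(θS(t)) h(J_t) is at least e^x min h. -/
lemma IsMAP.tail_discrete [Fintype E] [Nonempty E] (hM : IsMAP ℱ P J S) {θ : ℝ} (hθ : θ ∈ mgfDomain P S)
    {κ : ℝ} {h : E → ℝ} (hpos : ∀ j, 0 < h j)
    (hh : (mgfMatrix P J S θ).mulVec h = Real.exp κ • h) (i : E) (t : ℕ) (x : ℝ) :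
    (P i).real {ω | x ≤ θ * S t ω} ≤ h i * Real.exp (t * κ - x) / minEntry h := by
  have := hM.prob i
  have hL := hM.lintegral_exp_le hθ hpos (Real.exp_pos κ) hh i t
  have hm := minEntry_pos hpos
  have hε : 0 < Real.exp x * minEntry h := mul_pos (Real.exp_pos x) hm
  have hmeas : Measurable fun ω => ENNReal.ofReal (Real.exp (θ * S t ω) * h (J t ω)) :=
    ((Real.measurable_exp.comp ((hM.measurable_S t).const_mul θ)).mul
      (hM.measurable_J t h)).ennreal_ofReal
  have h1 : P i {ω | x ≤ θ * S t ω} ≤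
      ENNReal.ofReal (Real.exp κ ^ t * h i / (Real.exp x * minEntry h)) := by
    rw [ENNReal.ofReal_div_of_pos hε]
    refine le_trans (measure_mono fun ω hω => ?_) ((meas_ge_le_lintegral_div hmeas.aemeasurable
      (ENNReal.ofReal_pos.2 hε).ne' ENNReal.ofReal_ne_top).trans
      (ENNReal.div_le_div_right hL _))
    exact ENNReal.ofReal_le_ofReal (mul_le_mul (Real.exp_le_exp.2 hω) (minEntry_le h _) hm.le
      (Real.exp_pos _).le)
  refine (ENNReal.toReal_le_of_le_ofReal (div_nonneg (mul_nonneg (by positivity) (hpos i).le)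
    hε.le) h1).trans_eq ?_
  rw [← Real.exp_nat_mul, Real.exp_sub]
  field_simp

variable [Fintype E] [DecidableEq E] [Nonempty E]

/-- The spectral radius of the moment generating matrix has a positive eigenvector. -/
lemma IsMAP.exists_pos_eigenvector_mgfMatrix (hM : IsMAP ℱ P J S)
    (hirr : IrreducibleChain (transitionMatrix P J)) {θ : ℝ} (hθ : θ ∈ mgfDomain P S) :
    IrreducibleChain (mgfMatrix P J S θ) ∧ ∃ h : E → ℝ, (∀ i, 0 < h i) ∧
      (mgfMatrix P J S θ).mulVec h = Real.exp (discreteKappa P J S θ) • h := by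
  have hirr' : IrreducibleChain (mgfMatrix P J S θ) := fun i j =>
    Relation.ReflTransGen.mono (fun a b (hab : a ≠ b ∧ 0 < transitionMatrix P J a b) =>
      ⟨hab.1, mgfMatrix_pos hθ hab.2⟩) _ _ (hirr i j)
  obtain ⟨r, h, hpos, hh⟩ := exists_pos_eigenvector (fun i j _ => mgfMatrix_nonneg θ i j) hirr'
  -- Positivity is needed for exp(log r) = r. It comes from a transition row summing to 1, since
  -- irreducibility says nothing when E has one state.
  have hr : 0 < r := by
    obtain ⟨i⟩ := ‹Nonempty E›
    obtain ⟨j, -, hj⟩ : ∃ j ∈ Finset.univ, transitionMatrix P J i j ≠ 0 :=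
      Finset.exists_ne_zero_of_sum_ne_zero (by
        rw [hM.sum_transitionMatrix i]
        exact one_ne_zero)
    have hj' : 0 < transitionMatrix P J i j := lt_of_le_of_ne measureReal_nonneg hj.symm
    have hsum : 0 < (mgfMatrix P J S θ).mulVec h i :=
      Finset.sum_pos' (fun k _ => mul_nonneg (mgfMatrix_nonneg θ i k) (hpos k).le)
        ⟨j, Finset.mem_univ j, mul_pos (mgfMatrix_pos hθ hj') (hpos j)⟩
    rw [hh] at hsum
    exact pos_of_mul_pos_left hsum (hpos i).le
  refine ⟨hirr', h, hpos, ?_⟩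
  rw [discreteKappa, maxModulus_eq (fun i j => mgfMatrix_nonneg θ i j) hr.le hpos hh,
    Real.exp_log hr, hh]

end Discrete

/-! ### The sigmoid as a bounded substitute for the exponential -/

section Sigmoid

open Real

/-- With y = e^x the sigmoid is the concave function y/(1+y), whose derivative is 1/(1+y)^2. This is
its tangent inequality between y and y e^d; the gap is an explicit nonnegative fraction. -/
lemma sigmoid_add_sub_le (x d : ℝ) :
    sigmoid (x + d) - sigmoid x ≤ sigmoid x * (1 - sigmoid x) * (exp d - 1) := by
  have hform : ∀ x, sigmoid x = exp x / (1 + exp x) := fun x => by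
    rw [sigmoid_def, exp_neg]
    have := exp_pos x
    field_simp
    ring
  rw [hform, hform, exp_add]
  set y := exp x
  set u := exp d
  have hy : 0 < y := exp_pos x
  have hu : 0 < u := exp_pos d
  have key : y / (1 + y) * (1 - y / (1 + y)) * (u - 1) - (y * u / (1 + y * u) - y / (1 + y)) =
      y ^ 2 * (u - 1) ^ 2 / ((1 + y) ^ 2 * (1 + y * u)) := by
    field_simp
    ring
  have : 0 ≤ y ^ 2 * (u - 1) ^ 2 / ((1 + y) ^ 2 * (1 + y * u)) := by positivity
  linarith

lemma abs_sigmoid_le (x : ℝ) : |sigmoid x| ≤ 1 := by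
  rw [abs_of_nonneg (sigmoid_nonneg x)]
  exact sigmoid_le_one x

lemma abs_one_sub_sigmoid_le (x : ℝ) : |1 - sigmoid x| ≤ 1 := by
  rw [← sigmoid_neg]
  exact abs_sigmoid_le _

lemma abs_sigmoid_deriv_le (x : ℝ) : |sigmoid x * (1 - sigmoid x)| ≤ 1 := by
  rw [abs_mul]
  exact mul_le_one₀ (abs_sigmoid_le x) (abs_nonneg _) (abs_one_sub_sigmoid_le x)

lemma sigmoid_deriv_nonneg (x : ℝ) : 0 ≤ sigmoid x * (1 - sigmoid x) :=
  mul_nonneg (sigmoid_nonneg x) (sub_nonneg.2 (sigmoid_le_one x))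

lemma abs_sigmoid_sub_le (x y : ℝ) : |sigmoid x - sigmoid y| ≤ |x - y| := by
  have := Convex.norm_image_sub_le_of_norm_hasDerivWithin_le (f := sigmoid) (s := Set.univ)
    (C := 1) (fun z _ => (hasDerivAt_sigmoid z).hasDerivWithinAt)
    (fun z _ => abs_sigmoid_deriv_le z) convex_univ (Set.mem_univ y) (Set.mem_univ x)
  simpa using this

lemma sigmoid_le_exp (x : ℝ) : sigmoid x ≤ exp x := by
  rw [sigmoid_def, ← inv_inv (exp x), ← exp_neg]
  exact inv_anti₀ (exp_pos _) (by linarith)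

lemma hasDerivAt_sigmoid_affine (a θ s : ℝ) : HasDerivAt (fun s => sigmoid (a + θ * s))
    (θ * (sigmoid (a + θ * s) * (1 - sigmoid (a + θ * s)))) s := by
  have h1 : HasDerivAt (fun s => a + θ * s) θ s := by
    simpa using ((hasDerivAt_id s).const_mul θ).const_add a
  exact ((hasDerivAt_sigmoid (a + θ * s)).comp s h1).congr_deriv (mul_comm _ _)

lemma deriv_sigmoid_affine (a θ : ℝ) : deriv (fun s => sigmoid (a + θ * s)) =
    fun s => θ * (sigmoid (a + θ * s) * (1 - sigmoid (a + θ * s))) :=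
  funext fun s => (hasDerivAt_sigmoid_affine a θ s).deriv

lemma iteratedDeriv_two_sigmoid_affine (a θ s : ℝ) :
    iteratedDeriv 2 (fun s => sigmoid (a + θ * s)) s =
      θ ^ 2 * (sigmoid (a + θ * s) * (1 - sigmoid (a + θ * s)) *
        (1 - 2 * sigmoid (a + θ * s))) := by
  rw [iteratedDeriv_succ, iteratedDeriv_one, deriv_sigmoid_affine]
  have h := hasDerivAt_sigmoid_affine a θ s
  have h2 := (h.mul (h.const_sub 1)).const_mul θ
  refine (h2.congr_deriv ?_).deriv
  ring

lemma isTestFunction_sigmoid {E : Type*} (a : E → ℝ) (θ : ℝ) :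
    IsTestFunction fun j s => sigmoid (a j + θ * s) := by
  intro j
  refine ⟨(contDiff_sigmoid.of_le le_top).comp (by fun_prop), 1 + |θ| + θ ^ 2, fun s => ?_⟩
  have h0 := abs_nonneg θ
  have h1 := sq_nonneg θ
  rw [deriv_sigmoid_affine, iteratedDeriv_two_sigmoid_affine]
  refine ⟨(abs_sigmoid_le _).trans (by linarith), ?_, ?_⟩
  · rw [abs_mul]
    have := mul_le_of_le_one_right h0 (abs_sigmoid_deriv_le (a j + θ * s))
    linarith
  · rw [abs_mul, abs_mul, abs_of_nonneg h1]
    have h2 : |1 - 2 * sigmoid (a j + θ * s)| ≤ 1 := by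
      have := sigmoid_nonneg (a j + θ * s)
      have := sigmoid_le_one (a j + θ * s)
      rw [abs_le]
      constructor <;> linarith
    have := mul_le_of_le_one_right h1
      (mul_le_one₀ (abs_sigmoid_deriv_le (a j + θ * s)) (abs_nonneg _) h2)
    linarith

end Sigmoid

/-! ### The generator on test functions and on sigmoids -/

section Generator

variable {E : Type*} [Fintype E] (D : Characteristics E)

/-- The Lévy measure may be infinite near 0; this function dominates increments of bounded Lipschitz
functions. -/
lemma Characteristics.integrable_min (i : E) : Integrable (fun x : ℝ => min |x| 1) (D.levy i) := by
  rw [← integrableOn_univ, ← Set.union_compl_self (Set.Icc (-1 : ℝ) 1)]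
  have hmeas : Measurable fun x : ℝ => min |x| 1 := by fun_prop
  refine IntegrableOn.union ?_ ?_
  · refine (D.levy_small i 1 one_pos).mono' hmeas.aestronglyMeasurable (ae_of_all _ fun x => ?_)
    rw [Real.norm_of_nonneg (le_min (abs_nonneg x) zero_le_one)]
    exact min_le_left _ _
  · refine IntegrableOn.of_bound (C := 1) (D.levy_large i 1 one_pos) hmeas.aestronglyMeasurable
      (ae_of_all _ fun x => ?_)
    rw [Real.norm_of_nonneg (le_min (abs_nonneg x) zero_le_one)]
    exact min_le_right _ _

/-- Increments of a bounded function with bounded derivative. -/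
lemma abs_sub_le_min {f : ℝ → ℝ} (hf : Differentiable ℝ f) {C : ℝ}
    (hC : ∀ s, |f s| ≤ C ∧ |deriv f s| ≤ C) (s x : ℝ) :
    |f (s + x) - f s| ≤ 2 * C * min |x| 1 := by
  have hC0 : 0 ≤ C := (abs_nonneg _).trans (hC 0).1
  have h1 : |f (s + x) - f s| ≤ C * |x| := by
    have := Convex.norm_image_sub_le_of_norm_hasDerivWithin_le (f := f) (s := Set.univ)
      (C := C) (fun z _ => (hf z).hasDerivAt.hasDerivWithinAt)
      (fun z _ => (hC z).2) convex_univ (Set.mem_univ s) (Set.mem_univ (s + x))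
    simpa using this
  have h2 : |f (s + x) - f s| ≤ 2 * C := by
    have := abs_sub (f (s + x)) (f s)
    linarith [(hC (s + x)).1, (hC s).1]
  rcases le_total |x| 1 with hx | hx
  · rw [min_eq_left hx]
    nlinarith [abs_nonneg x]
  · rw [min_eq_right hx, mul_one]
    exact h2

variable {D} in
lemma IsTestFunction.integrable_sub {f : E → ℝ → ℝ} (hf : IsTestFunction f) (i j : E) (s : ℝ) :
    Integrable (fun x => f i (s + x) - f i s) (D.levy j) := by
  obtain ⟨hc, C, hC⟩ := hf i
  refine ((D.integrable_min j).const_mul (2 * C)).mono' ?_ (ae_of_all _ fun x =>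
    abs_sub_le_min (hc.differentiable two_ne_zero) (fun s => ⟨(hC s).1, (hC s).2.1⟩) s x)
  exact ((hc.continuous.comp (continuous_const.add continuous_id)).sub
    continuous_const).aestronglyMeasurable

variable [DecidableEq E]

/-- The generator maps test functions to bounded continuous functions. -/
lemma Characteristics.generator_eq_bounded {f : E → ℝ → ℝ} (hf : IsTestFunction f) (i : E) :
    ∃ F : BoundedContinuousFunction ℝ ℝ, ∀ s, F s = D.generator f i s := by
  choose hc C hC using hf
  have hd : ∀ j, Continuous (deriv (f j)) := fun j => (hc j).continuous_deriv one_le_two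
  have hd2 : ∀ j, Continuous (iteratedDeriv 2 (f j)) := fun j =>
    (hc j).continuous_iteratedDeriv 2 le_rfl
  have hint : Continuous fun s => ∫ x, (f i (s + x) - f i s) ∂(D.levy i) := by
    refine continuous_of_dominated (bound := fun x => 2 * C i * min |x| 1) (fun s => ?_)
      (fun s => ae_of_all _ fun x => abs_sub_le_min ((hc i).differentiable two_ne_zero)
        (fun s => ⟨(hC i s).1, (hC i s).2.1⟩) s x) ((D.integrable_min i).const_mul _)
      (ae_of_all _ fun x => ?_)
    · have := (hc i).continuous
      exact Continuous.aestronglyMeasurable (by fun_prop)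
    · have := (hc i).continuous
      fun_prop
  have hintb : ∀ s, ‖∫ x, (f i (s + x) - f i s) ∂(D.levy i)‖ ≤
      ∫ x, 2 * C i * min |x| 1 ∂(D.levy i) := fun s =>
    norm_integral_le_of_norm_le ((D.integrable_min i).const_mul _)
      (ae_of_all _ fun x => abs_sub_le_min ((hc i).differentiable two_ne_zero)
        (fun s => ⟨(hC i s).1, (hC i s).2.1⟩) s x)
  have hjump : ∀ j, Continuous fun s => ∫ x, f j (s + x) ∂(D.jumpLaw i j) := fun j => by
    have := D.jumpLaw_prob i j
    have := (hc j).continuous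
    refine continuous_of_dominated (bound := fun _ => C j) (fun s => ?_)
      (fun s => ae_of_all _ fun x => (hC j _).1) (integrable_const _) (ae_of_all _ fun x => ?_)
    · exact Continuous.aestronglyMeasurable (by fun_prop)
    · fun_prop
  have hjumpb : ∀ j s, ‖∫ x, f j (s + x) ∂(D.jumpLaw i j)‖ ≤ C j := fun j s => by
    have := D.jumpLaw_prob i j
    refine (norm_integral_le_of_norm_le (integrable_const (C j))
      (ae_of_all _ fun x => (hC j _).1)).trans_eq ?_
    simp
  let F := fun j => BoundedContinuousFunction.ofNormedAddCommGroup (f j) (hc j).continuous (C j)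
    fun s => (hC j s).1
  let F1 := BoundedContinuousFunction.ofNormedAddCommGroup _ (hd i) (C i) fun s => (hC i s).2.1
  let F2 := BoundedContinuousFunction.ofNormedAddCommGroup _ (hd2 i) (C i) fun s => (hC i s).2.2
  let F3 := BoundedContinuousFunction.ofNormedAddCommGroup _ hint _ hintb
  let G := fun j => BoundedContinuousFunction.ofNormedAddCommGroup _ (hjump j) _ (hjumpb j)
  refine ⟨D.drift i • F1 + (D.vol i ^ 2 / 2) • F2 + F3 + ∑ j ∈ Finset.univ.erase i,
    D.rate i j • ((1 - D.jumpProb i j) • F j + D.jumpProb i j • G j - F i), fun s => ?_⟩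
  simp [F, F1, F2, F3, G, Characteristics.generator]

lemma Characteristics.K_diag (θ : ℝ) (i : E) : D.K θ i i = D.rate i i + D.exponent i θ := by
  simp [Characteristics.K]

/-- Written as the rate times the transform of a jump that is 0 with probability 1 - q, the entry is
visibly nonnegative. -/
lemma Characteristics.K_offDiag (θ : ℝ) {i j : E} (hij : i ≠ j) : D.K θ i j =
    D.rate i j * (1 - D.jumpProb i j + D.jumpProb i j * ∫ x, Real.exp (θ * x) ∂(D.jumpLaw i j)) := by
  simp only [Characteristics.K, Matrix.of_apply, if_neg hij]
  ring

lemma Characteristics.K_nonneg (θ : ℝ) {i j : E} (hij : i ≠ j) : 0 ≤ D.K θ i j := by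
  rw [D.K_offDiag θ hij]
  have h := D.jumpProb_mem i j
  exact mul_nonneg (D.rate_nonneg i j hij) (add_nonneg (sub_nonneg.2 h.2)
    (mul_nonneg h.1 (integral_nonneg fun _ => (Real.exp_pos _).le)))

lemma Characteristics.K_pos {θ : ℝ} (hθ : θ ∈ D.domain) {i j : E} (hij : i ≠ j)
    (hrate : 0 < D.rate i j) : 0 < D.K θ i j := by
  rw [D.K_offDiag θ hij]
  have h := D.jumpProb_mem i j
  have := D.jumpLaw_prob i j
  refine mul_pos hrate ?_
  rcases h.1.eq_or_lt with h0 | h0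
  · simp [← h0]
  · exact add_pos_of_nonneg_of_pos (sub_nonneg.2 h.2)
      (mul_pos h0 (integral_exp_pos (hθ.2 i j hij (mul_pos hrate h0))))

/-- For the eigenvector `h` of `K[θ]`, the generator applied to the sigmoid of
`log h(j) + θ s` is bounded by `κ` times the derivative of the sigmoid. -/
lemma Characteristics.generator_sigmoid_le {θ : ℝ} (hθ : θ ∈ D.domain) {κ : ℝ} {h : E → ℝ}
    (hpos : ∀ j, 0 < h j) (hh : (D.K θ).mulVec h = κ • h) (b : ℝ) (i : E) (s : ℝ) :
    D.generator (fun j s => Real.sigmoid (b + Real.log (h j) + θ * s)) i s ≤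
      κ * (Real.sigmoid (b + Real.log (h i) + θ * s) *
        (1 - Real.sigmoid (b + Real.log (h i) + θ * s))) := by
  have htest := isTestFunction_sigmoid (fun j => b + Real.log (h j)) θ
  set Z := fun j => b + Real.log (h j) + θ * s with hZ
  set w := Real.sigmoid (Z i) * (1 - Real.sigmoid (Z i)) with hw
  have hw0 : 0 ≤ w := sigmoid_deriv_nonneg _
  -- The tangent inequality with e^d = (h_j / h_i) e^(θx), the factor by which M changes in a jump.
  have hinc : ∀ j x, Real.sigmoid (b + Real.log (h j) + θ * (s + x)) - Real.sigmoid (Z i) ≤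
      w * (h j / h i * Real.exp (θ * x) - 1) := by
    intro j x
    have := sigmoid_add_sub_le (Z i) (Real.log (h j / h i) + θ * x)
    rw [Real.exp_add, Real.exp_log (div_pos (hpos j) (hpos i)),
      Real.log_div (hpos j).ne' (hpos i).ne'] at this
    refine le_trans (le_of_eq ?_) this
    simp only [hZ]
    congr 2
    ring
  have hlevy : ∫ x, (Real.sigmoid (b + Real.log (h i) + θ * (s + x)) - Real.sigmoid (Z i))
      ∂(D.levy i) ≤ w * ∫ x, (Real.exp (θ * x) - 1) ∂(D.levy i) := by
    rw [← integral_const_mul]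
    refine integral_mono (htest.integrable_sub (D := D) i i s) ((hθ.1 i).const_mul w) fun x => ?_
    have := hinc i x
    rwa [div_self (hpos i).ne', one_mul] at this
  -- The second derivative of the sigmoid is w(1 - 2σ), at most its first derivative w.
  have hvol : D.vol i ^ 2 / 2 * (θ ^ 2 * (w * (1 - 2 * Real.sigmoid (Z i)))) ≤
      w * (θ ^ 2 * D.vol i ^ 2 / 2) := by
    have h1 : w * (1 - 2 * Real.sigmoid (Z i)) ≤ w :=
      mul_le_of_le_one_right hw0 (by linarith [Real.sigmoid_nonneg (Z i)])
    have h2 : 0 ≤ D.vol i ^ 2 / 2 * θ ^ 2 := by positivity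
    nlinarith [mul_le_mul_of_nonneg_left h1 h2]
  have hjump : ∀ j, j ≠ i → D.rate i j * ((1 - D.jumpProb i j) * Real.sigmoid (Z j)
      + D.jumpProb i j * (∫ x, Real.sigmoid (b + Real.log (h j) + θ * (s + x)) ∂(D.jumpLaw i j))
      - Real.sigmoid (Z i)) ≤ w * (D.K θ i j * h j / h i - D.rate i j) := by
    intro j hj
    have hq := D.jumpProb_mem i j
    have := D.jumpLaw_prob i j
    have hst : Real.sigmoid (Z j) - Real.sigmoid (Z i) ≤ w * (h j / h i - 1) := by
      simpa using hinc j 0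
    have hpr : D.rate i j * (D.jumpProb i j * ((∫ x, Real.sigmoid
        (b + Real.log (h j) + θ * (s + x)) ∂(D.jumpLaw i j)) - Real.sigmoid (Z i))) ≤
        D.rate i j * (D.jumpProb i j * (w * (h j / h i * (∫ x, Real.exp (θ * x) ∂(D.jumpLaw i j))
          - 1))) := by
      -- Integrability against the jump law is known only when such jumps occur; otherwise both
      -- sides vanish.
      rcases (mul_nonneg (D.rate_nonneg i j hj.symm) hq.1).eq_or_lt with h0 | h0
      · rw [← mul_assoc, ← mul_assoc, ← h0, zero_mul, zero_mul]
      · rw [← mul_assoc, ← mul_assoc]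
        refine mul_le_mul_of_nonneg_left ?_ h0.le
        have hexp := hθ.2 i j hj.symm h0
        have hsig : Integrable (fun x => Real.sigmoid (b + Real.log (h j) + θ * (s + x)))
            (D.jumpLaw i j) := by
          refine Integrable.of_bound (C := 1) (Continuous.aestronglyMeasurable ?_)
            (ae_of_all _ fun x => abs_sigmoid_le _)
          have := continuous_sigmoid
          fun_prop
        have := integral_mono (hsig.sub (integrable_const (Real.sigmoid (Z i))))
          (((hexp.const_mul (h j / h i)).sub (integrable_const 1)).const_mul w)
          fun x => hinc j x
        simpa [integral_sub, integral_const_mul, hsig, hexp.const_mul] using this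
    have hrq : 0 ≤ D.rate i j * (1 - D.jumpProb i j) :=
      mul_nonneg (D.rate_nonneg i j hj.symm) (sub_nonneg.2 hq.2)
    have h3 := mul_le_mul_of_nonneg_left hst hrq
    rw [D.K_offDiag θ hj.symm]
    refine le_trans (le_of_eq ?_) ((add_le_add h3 hpr).trans_eq ?_)
    · ring
    · ring
  -- Row i of Kh = κh divided by h_i, combined with the zero row sums of the intensity matrix.
  have hsum : ∑ j ∈ Finset.univ.erase i, (D.K θ i j * h j / h i - D.rate i j) =
      κ - D.exponent i θ := by
    have h1 : ∑ j ∈ Finset.univ.erase i, D.rate i j = - D.rate i i := by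
      have := Finset.add_sum_erase Finset.univ (fun j => D.rate i j) (Finset.mem_univ i)
      rw [D.rate_sum] at this
      linarith
    have h2 : ∑ j ∈ Finset.univ.erase i, D.K θ i j * h j = κ * h i - D.K θ i i * h i := by
      have h3 := Finset.add_sum_erase Finset.univ (fun j => D.K θ i j * h j) (Finset.mem_univ i)
      have h4 : ∑ j, D.K θ i j * h j = κ * h i := congrFun hh i
      linarith
    rw [Finset.sum_sub_distrib, ← Finset.sum_div, h1, h2, D.K_diag]
    have := (hpos i).ne'
    field_simp
    ring
  have hsum' := Finset.sum_le_sum fun j (hj : j ∈ Finset.univ.erase i) =>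
    hjump j (Finset.ne_of_mem_erase hj)
  rw [← Finset.mul_sum, hsum] at hsum'
  unfold Characteristics.generator
  rw [iteratedDeriv_two_sigmoid_affine, deriv_sigmoid_affine]
  simp only [Characteristics.exponent] at hsum'
  have e1 : D.drift i * (θ * w) = w * (θ * D.drift i) := by ring
  calc _ ≤ w * (θ * D.drift i) + w * (θ ^ 2 * D.vol i ^ 2 / 2)
        + w * ∫ x, (Real.exp (θ * x) - 1) ∂(D.levy i)
        + w * (κ - (θ * D.drift i + θ ^ 2 * D.vol i ^ 2 / 2
          + ∫ x, (Real.exp (θ * x) - 1) ∂(D.levy i))) :=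
        add_le_add (add_le_add (add_le_add e1.le hvol) hlevy) hsum'
    _ = _ := by ring

end Generator

/-- A right-continuous real function is Borel measurable. -/
lemma measurable_of_rightContinuous {g : ℝ → ℝ} (hg : ∀ u, ContinuousWithinAt g (Set.Ioi u) u) :
    Measurable g := by
  -- Sample g at the first point of the grid of mesh 1/(n+1) strictly to the right of u; strictness
  -- is what lets right-continuity apply.
  refine measurable_of_tendsto_metrizable (f := fun (n : ℕ) u => g ((⌊((n : ℝ) + 1) * u⌋ + 1) / ((n : ℝ) + 1)))
    (fun n => ?_) (tendsto_pi_nhds.2 fun u => ?_)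
  · exact (measurable_from_top (f := fun k : ℤ => g ((k + 1) / (n + 1)))).comp
      (Int.measurable_floor.comp (measurable_const_mul _))
  · have hgt : ∀ n : ℕ, u < (⌊((n : ℝ) + 1) * u⌋ + 1) / ((n : ℝ) + 1) := fun n => by
      rw [lt_div_iff₀ (by positivity), mul_comm]
      exact Int.lt_floor_add_one _
    refine (hg u).tendsto.comp (tendsto_nhdsWithin_iff.2 ⟨?_, Eventually.of_forall hgt⟩)
    have hlim : Tendsto (fun n : ℕ => u + 1 / ((n : ℝ) + 1)) atTop (𝓝 u) := by
      simpa using tendsto_const_nhds.add (tendsto_one_div_add_atTop_nhds_zero_nat (𝕜 := ℝ))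
    refine tendsto_of_tendsto_of_tendsto_of_le_of_le tendsto_const_nhds hlim
      (fun n => (hgt n).le) fun n => ?_
    simp only
    have hn : (0 : ℝ) < n + 1 := by positivity
    have hmul : (u + 1 / ((n : ℝ) + 1)) * (n + 1) = (n + 1) * u + 1 := by
      field_simp
    rw [div_le_iff₀ hn, hmul]
    linarith [Int.floor_le (((n : ℝ) + 1) * u)]

/-! ### Continuous time: Dynkin's formula and tails -/

section Dynkin

variable {E Ω : Type*} [Fintype E] [DecidableEq E] [mΩ : MeasurableSpace Ω]
  {D : Characteristics E} {ℱ : Filtration ℝ≥0 mΩ} {P : E → Measure Ω} {J : ℝ≥0 → Ω → E}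
  {S : ℝ≥0 → Ω → ℝ}

lemma tendsto_toNNReal_right (u : ℝ) (hu : 0 ≤ u) :
    Tendsto Real.toNNReal (𝓝[>] u) (𝓝[>] u.toNNReal) := by
  refine tendsto_nhdsWithin_iff.2 ⟨(continuous_real_toNNReal.tendsto u).mono_left
    nhdsWithin_le_nhds, ?_⟩
  filter_upwards [self_mem_nhdsWithin] with z hz
  exact (Real.toNNReal_lt_toNNReal_iff (hu.trans_lt hz)).2 hz

/-- Continuous functions of the state are right-continuous along the paths. -/
lemma IsContinuousMAP.rightContinuous (hM : IsContinuousMAP D ℱ P J S) {φ : E → ℝ → ℝ}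
    (hφ : ∀ j, Continuous (φ j)) (ω : Ω) (u : ℝ) :
    ContinuousWithinAt (fun u : ℝ => φ (J u.toNNReal ω) (S u.toNNReal ω)) (Set.Ioi u) u := by
  rcases le_or_gt 0 u with hu | hu
  · have ht := tendsto_toNNReal_right u hu
    refine Tendsto.congr' ?_ (((hφ (J u.toNNReal ω)).tendsto _).comp
      ((hM.S_right ω u.toNNReal).comp ht))
    filter_upwards [ht.eventually (hM.J_right ω u.toNNReal)] with z hz
    simp only [Function.comp_apply, hz]
  -- Truncation to nonnegative times makes the path constant on the negative half-line.
  · refine ContinuousAt.continuousWithinAt (ContinuousAt.congr continuousAt_const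
      (f := fun _ => φ (J 0 ω) (S 0 ω)) ?_)
    filter_upwards [Iio_mem_nhds hu] with z hz
    rw [Real.toNNReal_of_nonpos (le_of_lt hz)]

lemma IsContinuousMAP.measurable_state (hM : IsContinuousMAP D ℱ P J S) {φ : E → ℝ → ℝ}
    (hφ : ∀ j, Measurable (φ j)) (t : ℝ≥0) : Measurable fun ω => φ (J t ω) (S t ω) := by
  have heq : (fun ω => φ (J t ω) (S t ω)) = fun ω =>
      ∑ j, {ω | J t ω = j}.indicator (fun ω => φ j (S t ω)) ω := by
    funext ω
    rw [Finset.sum_eq_single (J t ω)]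
    · simp
    · intro j _ hj
      exact Set.indicator_of_notMem (by simpa using hj.symm) _
    · simp
  rw [heq]
  exact Finset.measurable_fun_sum _ fun j _ => ((hφ j).comp (hM.isMAP.measurable_S t)).indicator
    (ℱ.le t _ (hM.isMAP.adapted_J t j))

/-- Dynkin's formula for bounded test functions. -/
lemma IsContinuousMAP.dynkin (hM : IsContinuousMAP D ℱ P J S) {f : E → ℝ → ℝ}
    (hf : IsTestFunction f) : ∃ C : ℝ, ∀ (i : E) (s t : ℝ), 0 ≤ s → 0 ≤ t →
      (∀ ω, Tendsto (fun z => (z - s)⁻¹ *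
          ∫ u in s..z, D.generator f (J u.toNNReal ω) (S u.toNNReal ω)) (𝓝[>] s)
          (𝓝 (D.generator f (J s.toNNReal ω) (S s.toNNReal ω)))) ∧
      (∀ ω, |∫ u in s..t, D.generator f (J u.toNNReal ω) (S u.toNNReal ω)| ≤ C * |t - s|) ∧
      Integrable (fun ω => ∫ u in s..t, D.generator f (J u.toNNReal ω) (S u.toNNReal ω)) (P i) ∧
      ∫ ω, f (J t.toNNReal ω) (S t.toNNReal ω) ∂(P i)
        - ∫ ω, f (J s.toNNReal ω) (S s.toNNReal ω) ∂(P i) =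
        ∫ ω, (∫ u in s..t, D.generator f (J u.toNNReal ω) (S u.toNNReal ω)) ∂(P i) := by
  choose F hF using D.generator_eq_bounded hf
  have hA : ∀ i s, D.generator f i s = F i s := fun i s => (hF i s).symm
  have hmart := fun i => hM.martingale i f hf
  simp only [hA] at hmart ⊢
  obtain ⟨C, hC⟩ := Finite.exists_le fun j => ‖F j‖
  have hFC : ∀ j s, ‖F j s‖ ≤ C := fun j s => ((F j).norm_coe_le_norm s).trans (hC j)
  have hrc := fun ω => hM.rightContinuous (φ := fun j => F j) (fun j => (F j).continuous) ω
  have hmeas := fun ω => measurable_of_rightContinuous (hrc ω)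
  have hii : ∀ ω a b, IntervalIntegrable
      (fun u : ℝ => F (J u.toNNReal ω) (S u.toNNReal ω)) volume a b := fun ω a b =>
    (intervalIntegrable_const (c := C)).mono_fun (hmeas ω).aestronglyMeasurable
      (ae_of_all _ fun u => (hFC _ _).trans (le_abs_self C))
  refine ⟨C, fun i s t hs ht => ⟨fun ω => ?_, fun ω => ?_, ?_⟩⟩
  · have h := intervalIntegral.integral_hasDerivWithinAt_right (hii ω s s) (s := Set.Ici s)
      (t := Set.Ioi s) ((hmeas ω).stronglyMeasurable.stronglyMeasurableAtFilter) (hrc ω s)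
    refine ((hasDerivWithinAt_iff_tendsto_slope' (lt_irrefl s)).1 h.Ioi_of_Ici).congr fun z => ?_
    rw [slope_def_field, intervalIntegral.integral_same, sub_zero, div_eq_inv_mul]
  · exact intervalIntegral.norm_integral_le_of_norm_le_const fun u _ => hFC _ _
  · have := hM.isMAP.prob i
    have hm := hmart i
    have hfint : ∀ t, Integrable (fun ω => f (J t ω) (S t ω)) (P i) := fun t => by
      choose hc C hC using hf
      obtain ⟨C', hC'⟩ := Finite.exists_le C
      exact Integrable.of_bound (C := C') (hM.measurable_state
        (fun j => (hc j).continuous.measurable) t).aestronglyMeasurable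
        (ae_of_all _ fun ω => ((hC _ _).1).trans (hC' _))
    -- The time integral is the test function minus the martingale, both integrable, so no joint
    -- measurability in (u, ω) is required.
    have hI : ∀ r : ℝ, 0 ≤ r → Integrable
        (fun ω => ∫ u in (0 : ℝ)..r, F (J u.toNNReal ω) (S u.toNNReal ω)) (P i) := fun r hr => by
      refine ((hfint r.toNNReal).sub (hm.integrable r.toNNReal)).congr (ae_of_all _ fun ω => ?_)
      simp [Real.coe_toNNReal r hr]
    have hdiff : ∀ ω, ∫ u in s..t, F (J u.toNNReal ω) (S u.toNNReal ω) =
        (∫ u in (0 : ℝ)..t, F (J u.toNNReal ω) (S u.toNNReal ω)) -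
        ∫ u in (0 : ℝ)..s, F (J u.toNNReal ω) (S u.toNNReal ω) := fun ω =>
      (intervalIntegral.integral_interval_sub_left (hii ω 0 t) (hii ω 0 s)).symm
    have hconst : ∀ r : ℝ, 0 ≤ r → ∫ ω, f (J r.toNNReal ω) (S r.toNNReal ω) ∂(P i)
        - ∫ ω, (∫ u in (0 : ℝ)..r, F (J u.toNNReal ω) (S u.toNNReal ω)) ∂(P i) =
        ∫ ω, f (J 0 ω) (S 0 ω) ∂(P i) := fun r hr => by
      have h := hm.setIntegral_eq (zero_le (a := r.toNNReal)) MeasurableSet.univ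
      simp only [setIntegral_univ, Real.coe_toNNReal r hr, NNReal.coe_zero,
        intervalIntegral.integral_same, sub_zero] at h
      rw [← integral_sub (hfint _) (hI r hr), h]
    simp only [hdiff]
    refine ⟨(hI t ht).sub (hI s hs), ?_⟩
    rw [integral_sub (hI t ht) (hI s hs)]
    linarith [hconst s hs, hconst t ht]

/-- The right derivative of a smooth function along a moving base point. -/
lemma tendsto_div_of_hasStrictDerivAt {g : ℝ → ℝ} {g' x κ s : ℝ} (hg : HasStrictDerivAt g g' x)
    {X : ℝ → ℝ} (hX : Tendsto X (𝓝[>] s) (𝓝 x)) :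
    Tendsto (fun z => (z - s)⁻¹ * (g (X z - κ * (z - s)) - g (X z))) (𝓝[>] s)
      (𝓝 (-κ * g')) := by
  have hδ : Tendsto (fun z => z - s) (𝓝[>] s) (𝓝 0) := by
    have : Tendsto (fun z => z - s) (𝓝 s) (𝓝 (s - s)) := tendsto_id.sub tendsto_const_nhds
    rw [sub_self] at this
    exact this.mono_left nhdsWithin_le_nhds
  have hpair : Tendsto (fun z => (X z - κ * (z - s), X z)) (𝓝[>] s) (𝓝 (x, x)) := by
    refine Tendsto.prodMk_nhds ?_ hX
    simpa using hX.sub (hδ.const_mul κ)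
  -- Both arguments of g move towards x, so strict differentiability is used; their distance is |κ|
  -- |z - s|.
  have hO : ((fun p : ℝ × ℝ => p.1 - p.2) ∘ fun z => (X z - κ * (z - s), X z)) =O[𝓝[>] s]
      fun z => z - s :=
    Asymptotics.IsBigO.of_bound |κ| (Eventually.of_forall fun z => by simp)
  have ho := (hg.isLittleO.comp_tendsto hpair).trans_isBigO hO
  have h0 := ho.tendsto_div_nhds_zero.add_const (-κ * g')
  rw [zero_add] at h0
  refine h0.congr' ?_
  filter_upwards [self_mem_nhdsWithin] with z hz
  have hz' : z - s ≠ 0 := (sub_pos.2 hz).ne'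
  simp only [Function.comp_apply, ContinuousLinearMap.toSpanSingleton_apply, smul_eq_mul]
  field_simp
  ring

lemma hasStrictDerivAt_sigmoid (x : ℝ) :
    HasStrictDerivAt Real.sigmoid (Real.sigmoid x * (1 - Real.sigmoid x)) x := by
  have h := (contDiff_sigmoid.contDiffAt (x := x)).hasStrictDerivAt (by simp)
  rwa [Real.deriv_sigmoid] at h

/-- `E_i[σ (b - κ t + log h(J t) + θ S t)]` does not exceed its initial value. -/
lemma IsContinuousMAP.integral_sigmoid_le (hM : IsContinuousMAP D ℱ P J S) {θ : ℝ}
    (hθ : θ ∈ D.domain) {κ : ℝ} {h : E → ℝ} (hpos : ∀ j, 0 < h j)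
    (hh : (D.K θ).mulVec h = κ • h) (b : ℝ) (i : E) (t : ℝ≥0) :
    ∫ ω, Real.sigmoid (b - κ * t + Real.log (h (J t ω)) + θ * S t ω) ∂(P i) ≤
      Real.sigmoid (b + Real.log (h i)) := by
  have := hM.isMAP.prob i
  have hcs := continuous_sigmoid
  -- Test functions do not depend on time, so the time z in -κz is a frozen parameter.
  set f : ℝ → E → ℝ → ℝ := fun z j x => Real.sigmoid (b - κ * z + Real.log (h j) + θ * x) with hf
  have hfcont : ∀ z j, Continuous (f z j) := fun z j => by
    simp only [hf]
    fun_prop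
  have htest : ∀ z, IsTestFunction (f z) := fun z =>
    isTestFunction_sigmoid (fun j => b - κ * z + Real.log (h j)) θ
  have hfm : ∀ z (r : ℝ), Measurable fun ω => f z (J r.toNNReal ω) (S r.toNNReal ω) := fun z r =>
    hM.measurable_state (fun j => (hfcont z j).measurable) _
  have hfint : ∀ z (r : ℝ), Integrable (fun ω => f z (J r.toNNReal ω) (S r.toNNReal ω)) (P i) :=
    fun z r => Integrable.of_bound (C := 1) (hfm z r).aestronglyMeasurable
      (ae_of_all _ fun ω => abs_sigmoid_le _)
  choose C hC using fun z => hM.dynkin (htest z)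
  have hlip : ∀ z s j x, |f z j x - f s j x| ≤ |κ| * |z - s| := fun z s j x => by
    refine (abs_sigmoid_sub_le _ _).trans_eq ?_
    rw [← abs_mul, ← abs_neg]
    congr 1
    ring
  set v : ℝ → ℝ := fun z => ∫ ω, f z (J z.toNNReal ω) (S z.toNNReal ω) ∂(P i) with hv
  set G : ℝ → ℝ → Ω → ℝ := fun s z ω =>
    ∫ u in s..z, D.generator (f s) (J u.toNNReal ω) (S u.toNNReal ω) with hG
  -- The increment of v splits into the change of the frozen time at the final state and Dynkin's
  -- formula for the function frozen at s.
  have hvdiff : ∀ s z, 0 ≤ s → 0 ≤ z → v z - v s = ∫ ω,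
      (f z (J z.toNNReal ω) (S z.toNNReal ω) - f s (J z.toNNReal ω) (S z.toNNReal ω) + G s z ω)
        ∂(P i) := by
    intro s z hs hz
    obtain ⟨-, -, h3, h4⟩ := hC s i s z hs hz
    have h5 := integral_add ((hfint z z).sub (hfint s z)) h3
    have h6 := integral_sub (hfint z z) (hfint s z)
    refine Eq.trans ?_ h5.symm
    refine Eq.trans ?_ (congrArg₂ (· + ·) h6.symm h4)
    simp only [hv]
    ring
  have hbd : ∀ s z, 0 ≤ s → 0 ≤ z → ∀ ω,
      |f z (J z.toNNReal ω) (S z.toNNReal ω) - f s (J z.toNNReal ω) (S z.toNNReal ω) + G s z ω| ≤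
        (|κ| + C s) * |z - s| := by
    intro s z hs hz ω
    rw [add_mul]
    exact (abs_add_le _ _).trans (add_le_add (hlip _ _ _ _) ((hC s i s z hs hz).2.1 ω))
  have hvlip : ∀ s z, 0 ≤ s → 0 ≤ z → |v z - v s| ≤ (|κ| + C s) * |z - s| := by
    intro s z hs hz
    rw [hvdiff s z hs hz]
    change ‖(_ : ℝ)‖ ≤ _
    refine (norm_integral_le_of_norm_le (integrable_const ((|κ| + C s) * |z - s|))
      (ae_of_all _ (hbd s z hs hz))).trans_eq ?_
    simp
  have hvcont : ContinuousOn v (Set.Icc 0 t) := by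
    intro s hs
    have hlim : Tendsto (fun z => (|κ| + C s) * |z - s|) (𝓝[Set.Icc 0 (t : ℝ)] s) (𝓝 0) := by
      have : Continuous fun z => (|κ| + C s) * |z - s| := by fun_prop
      have := this.tendsto s
      simp only [sub_self, abs_zero, mul_zero] at this
      exact this.mono_left nhdsWithin_le_nhds
    rw [ContinuousWithinAt, tendsto_iff_norm_sub_tendsto_zero]
    refine tendsto_of_tendsto_of_tendsto_of_le_of_le' tendsto_const_nhds hlim
      (Eventually.of_forall fun z => norm_nonneg _) ?_
    filter_upwards [self_mem_nhdsWithin] with z hz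
    exact hvlip s z hs.1 hz.1
  -- The pathwise drift: the time derivative -κσ(1 - σ) plus the generator, which is at most κσ(1 -
  -- σ).
  set H : ℝ → Ω → ℝ := fun s ω => -κ * (f s (J s.toNNReal ω) (S s.toNNReal ω) *
    (1 - f s (J s.toNNReal ω) (S s.toNNReal ω)))
    + D.generator (f s) (J s.toNNReal ω) (S s.toNNReal ω) with hH
  have hH0 : ∀ s ω, H s ω ≤ 0 := fun s ω => by
    have := D.generator_sigmoid_le hθ hpos hh (b - κ * s) (J s.toNNReal ω) (S s.toNNReal ω)
    simp only [hH, hf]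
    linarith
  have hderiv : ∀ s ∈ Set.Ico 0 (t : ℝ),
      HasDerivWithinAt v (∫ ω, H s ω ∂(P i)) (Set.Ici s) s := by
    intro s hs
    rw [← hasDerivWithinAt_Ioi_iff_Ici,
      hasDerivWithinAt_iff_tendsto_slope' (Set.self_notMem_Ioi)]
    have hlim : Tendsto (fun z => ∫ ω, (z - s)⁻¹ * (f z (J z.toNNReal ω) (S z.toNNReal ω)
        - f s (J z.toNNReal ω) (S z.toNNReal ω) + G s z ω) ∂(P i)) (𝓝[>] s)
        (𝓝 (∫ ω, H s ω ∂(P i))) := by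
      refine tendsto_integral_filter_of_dominated_convergence (fun _ => |κ| + C s) ?_ ?_
        (integrable_const _) (ae_of_all _ fun ω => ?_)
      · filter_upwards [self_mem_nhdsWithin] with z hz
        exact ((((hfint z z).sub (hfint s z)).add
          (hC s i s z hs.1 (hs.1.trans (le_of_lt hz))).2.2.1).const_mul _).aestronglyMeasurable
      · filter_upwards [self_mem_nhdsWithin] with z hz
        refine ae_of_all _ fun ω => ?_
        have hzs : 0 < z - s := sub_pos.2 hz
        rw [norm_mul, norm_inv, Real.norm_of_nonneg hzs.le, inv_mul_le_iff₀ hzs, mul_comm]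
        refine (hbd s z hs.1 (hs.1.trans (le_of_lt hz)) ω).trans_eq ?_
        rw [abs_of_pos hzs]
      · simp only [mul_add]
        refine Tendsto.add ?_ ((hC s i s s hs.1 hs.1).1 ω)
        have hX := (hM.rightContinuous
          (φ := fun j x => b - κ * s + Real.log (h j) + θ * x) (fun j => by fun_prop) ω s).tendsto
        refine (tendsto_div_of_hasStrictDerivAt (κ := κ) (hasStrictDerivAt_sigmoid _) hX).congr
          fun z => ?_
        simp only [hf]
        congr 3
        ring
    refine hlim.congr' ?_
    filter_upwards [self_mem_nhdsWithin] with z hz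
    rw [integral_const_mul, ← hvdiff s z hs.1 (hs.1.trans (le_of_lt hz)), slope_def_field,
      div_eq_inv_mul]
  -- A continuous function with nonpositive right derivative stays below its initial value.
  have hfinal := image_le_of_deriv_right_le_deriv_boundary (B := fun _ => v 0) (B' := fun _ => 0)
    hvcont hderiv le_rfl continuousOn_const (fun x _ => hasDerivWithinAt_const x _ _)
    (fun s _ => integral_nonpos (hH0 s)) (Set.right_mem_Icc.2 t.2)
  have hv0 : v 0 = Real.sigmoid (b + Real.log (h i)) := by
    have hae : ∀ᵐ ω ∂(P i), f 0 (J (0 : ℝ).toNNReal ω) (S (0 : ℝ).toNNReal ω) =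
        Real.sigmoid (b + Real.log (h i)) := by
      filter_upwards [hM.isMAP.init i] with ω hω
      simp [hf, hω.1, hω.2]
    simp only [hv]
    rw [integral_congr_ae hae]
    simp
  rw [hv0] at hfinal
  simpa [hv, hf] using hfinal

/-- Markov's inequality for the sigmoid costs a factor 1 + e^(b+β), which tends to 1 as b → -∞.
Integrability of exp(θS(t)) is never needed. -/
lemma IsContinuousMAP.tail [Nonempty E] (hM : IsContinuousMAP D ℱ P J S) {θ : ℝ}
    (hθ : θ ∈ D.domain) {κ : ℝ} {h : E → ℝ} (hpos : ∀ j, 0 < h j)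
    (hh : (D.K θ).mulVec h = κ • h) (i : E) (t : ℝ≥0) (x : ℝ) :
    (P i).real {ω | x ≤ θ * S t ω} ≤ h i * Real.exp (t * κ - x) / minEntry h := by
  have := hM.isMAP.prob i
  have hm := minEntry_pos hpos
  have hcs := continuous_sigmoid
  set R := h i * Real.exp (t * κ - x) / minEntry h with hR
  set p := (P i).real {ω | x ≤ θ * S t ω} with hp
  -- On the event, β is a lower bound for -κt + log h(J_t) + θS(t).
  set β := -κ * t + Real.log (minEntry h) + x with hβ
  have key : ∀ b : ℝ, p ≤ R * (1 + Real.exp (b + β)) := by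
    intro b
    have h1 := hM.integral_sigmoid_le hθ hpos hh b i t
    have hmeas : Measurable fun ω =>
        Real.sigmoid (b - κ * t + Real.log (h (J t ω)) + θ * S t ω) :=
      hM.measurable_state (φ := fun j s => Real.sigmoid (b - κ * t + Real.log (h j) + θ * s))
        (fun j => Continuous.measurable (by fun_prop)) t
    have h2 := mul_meas_ge_le_integral_of_nonneg (μ := P i)
      (ae_of_all _ fun ω => Real.sigmoid_nonneg
        (b - κ * t + Real.log (h (J t ω)) + θ * S t ω))
      (Integrable.of_bound (C := 1) hmeas.aestronglyMeasurable
        (ae_of_all _ fun ω => abs_sigmoid_le _)) (Real.sigmoid (b + β))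
    have h3 : p ≤ (P i).real {ω | Real.sigmoid (b + β) ≤
        Real.sigmoid (b - κ * t + Real.log (h (J t ω)) + θ * S t ω)} := by
      refine measureReal_mono fun ω hω => ?_
      simp only [Set.mem_ofPred_eq] at hω ⊢
      rw [Real.sigmoid_le_iff]
      have := Real.log_le_log hm (minEntry_le h (J t ω))
      simp only [hβ]
      linarith
    have h4 : Real.sigmoid (b + β) * p ≤ Real.exp (b + Real.log (h i)) :=
      (mul_le_mul_of_nonneg_left h3 (Real.sigmoid_nonneg _)).trans
        (h2.trans (h1.trans (sigmoid_le_exp _)))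
    have h5 : (Real.sigmoid (b + β))⁻¹ * Real.exp (b + Real.log (h i)) =
        R * (1 + Real.exp (b + β)) := by
      have e1 : Real.exp (b + β) = Real.exp b * minEntry h * Real.exp (x - t * κ) := by
        rw [show b + β = b + Real.log (minEntry h) + (x - t * κ) by
          simp only [hβ]
          ring, Real.exp_add, Real.exp_add, Real.exp_log hm]
      have e2 : Real.exp (t * κ - x) = (Real.exp (x - t * κ))⁻¹ := by
        rw [← Real.exp_neg, neg_sub]
      rw [Real.sigmoid_def, inv_inv, Real.exp_neg, hR, e2, e1, Real.exp_add,
        Real.exp_log (hpos i)]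
      field_simp
      ring
    rw [← h5, ← div_eq_inv_mul, le_div_iff₀' (Real.sigmoid_pos _)]
    exact h4
  have hlim : Tendsto (fun b : ℝ => R * (1 + Real.exp (b + β))) atBot (𝓝 (R * (1 + 0))) :=
    ((Real.tendsto_exp_atBot.comp
      (tendsto_atBot_add_const_right _ β tendsto_id)).const_add 1).const_mul R
  rw [add_zero, mul_one] at hlim
  exact ge_of_tendsto' hlim key

/-- The rightmost eigenvalue of `K[θ]` has a positive eigenvector. -/
lemma Characteristics.exists_pos_eigenvector_K [Nonempty E] (D : Characteristics E)
    (hirr : IrreducibleChain D.rate) {θ : ℝ} (hθ : θ ∈ D.domain) :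
    IrreducibleChain (D.K θ) ∧ ∃ h : E → ℝ, (∀ i, 0 < h i) ∧
      (D.K θ).mulVec h = D.kappa θ • h := by
  have hirr' : IrreducibleChain (D.K θ) := fun i j =>
    Relation.ReflTransGen.mono (fun a b (hab : a ≠ b ∧ 0 < D.rate a b) =>
      ⟨hab.1, D.K_pos hθ hab.1 hab.2⟩) _ _ (hirr i j)
  obtain ⟨r, h, hpos, hh⟩ := exists_pos_eigenvector (fun i j => D.K_nonneg θ) hirr'
  refine ⟨hirr', h, hpos, ?_⟩
  rw [Characteristics.kappa, maxRealPart_eq (fun i j => D.K_nonneg θ) hpos hh, hh]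

end Dynkin

end MarkovAdditive

/-! ### The theorem in both time scales -/

theorem theorem1 {E Ω : Type*} [Fintype E] [DecidableEq E] [Nonempty E] [mΩ : MeasurableSpace Ω]
    (P : E → MeasureTheory.Measure Ω) :
    -- discrete time
    (∀ (ℱ : MeasureTheory.Filtration ℕ mΩ) (J : ℕ → Ω → E) (S : ℕ → Ω → ℝ) (π : E → ℝ),
      MarkovAdditive.IsMAP ℱ P J S →
      MarkovAdditive.IrreducibleChain (MarkovAdditive.transitionMatrix P J) →
      MarkovAdditive.IsStationaryDiscrete (MarkovAdditive.transitionMatrix P J) π →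
      -- the normalised right eigenvector is well defined and positive
      (∀ θ ∈ MarkovAdditive.mgfDomain P S,
        ∃! h, MarkovAdditive.IsDiscreteH P J S π θ h) ∧
      (∀ θ ∈ MarkovAdditive.mgfDomain P S,
        ∀ h, MarkovAdditive.IsDiscreteH P J S π θ h → ∀ j, 0 < h j) ∧
      ∀ θ > 0, ∀ i : E,
        -- lower bounds
        (θ ∈ MarkovAdditive.mgfDomain P S → ∀ h,
          MarkovAdditive.IsDiscreteH P J S π θ h →
          (∀ (t : ℕ) (x : ℝ),
            1 - h i * Real.exp (t * MarkovAdditive.discreteKappa P J S θ - θ * x)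
                / MarkovAdditive.minEntry h
              ≤ (P i).real {ω | S t ω ≤ x}) ∧
          (∀ (t : ℕ) (y : ℝ), 0 < t →
            1 - h i * Real.exp (-y) / MarkovAdditive.minEntry h
              ≤ (P i).real {ω | S t ω / t ≤
                (t * MarkovAdditive.discreteKappa P J S θ + y) / (θ * t)})) ∧
        -- upper bounds
        (-θ ∈ MarkovAdditive.mgfDomain P S → ∀ h,
          MarkovAdditive.IsDiscreteH P J S π (-θ) h →
          (∀ (t : ℕ) (x : ℝ),
            (P i).real {ω | S t ω ≤ x}
              ≤ h i * Real.exp (t * MarkovAdditive.discreteKappa P J S (-θ) + θ * x)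
                / MarkovAdditive.minEntry h) ∧
          (∀ (t : ℕ) (y : ℝ), 0 < t →
            (P i).real {ω | S t ω / t ≤
                (t * MarkovAdditive.discreteKappa P J S (-θ) + y) / (-θ * t)}
              ≤ h i * Real.exp (-y) / MarkovAdditive.minEntry h))) ∧
    -- continuous time
    (∀ (D : MarkovAdditive.Characteristics E) (ℱ : MeasureTheory.Filtration NNReal mΩ)
      (J : NNReal → Ω → E) (S : NNReal → Ω → ℝ) (π : E → ℝ),
      MarkovAdditive.IsContinuousMAP D ℱ P J S →
      MarkovAdditive.IrreducibleChain D.rate →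
      MarkovAdditive.IsStationaryContinuous D.rate π →
      -- the normalised right eigenvector is well defined and positive
      (∀ θ ∈ D.domain, ∃! h, D.IsH π θ h) ∧
      (∀ θ ∈ D.domain, ∀ h, D.IsH π θ h → ∀ j, 0 < h j) ∧
      ∀ θ > 0, ∀ i : E,
        -- lower bounds
        (θ ∈ D.domain → ∀ h, D.IsH π θ h →
          (∀ (t : NNReal) (x : ℝ),
            1 - h i * Real.exp (t * D.kappa θ - θ * x) / MarkovAdditive.minEntry h
              ≤ (P i).real {ω | S t ω ≤ x}) ∧
          (∀ (t : NNReal) (y : ℝ), 0 < t →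
            1 - h i * Real.exp (-y) / MarkovAdditive.minEntry h
              ≤ (P i).real {ω | S t ω / t ≤ (t * D.kappa θ + y) / (θ * t)})) ∧
        -- upper bounds
        (-θ ∈ D.domain → ∀ h, D.IsH π (-θ) h →
          (∀ (t : NNReal) (x : ℝ),
            (P i).real {ω | S t ω ≤ x}
              ≤ h i * Real.exp (t * D.kappa (-θ) + θ * x) / MarkovAdditive.minEntry h) ∧
          (∀ (t : NNReal) (y : ℝ), 0 < t →
            (P i).real {ω | S t ω / t ≤ (t * D.kappa (-θ) + y) / (-θ * t)}
              ≤ h i * Real.exp (-y) / MarkovAdditive.minEntry h))) := by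
  refine ⟨fun ℱ J S π hM hirr hπ => ?_, fun D ℱ J S π hM hirr hπ => ?_⟩
  · have hPF : ∀ θ ∈ MarkovAdditive.mgfDomain P S,
        (∃! h, MarkovAdditive.IsDiscreteH P J S π θ h) ∧
          ∀ h, MarkovAdditive.IsDiscreteH P J S π θ h → ∀ j, 0 < h j := fun θ hθ => by
      obtain ⟨hirr', h, hpos, hh⟩ := hM.exists_pos_eigenvector_mgfMatrix hirr hθ
      exact MarkovAdditive.isRightEigenvector_existsUnique_pos
        (fun i j _ => MarkovAdditive.mgfMatrix_nonneg θ i j) hirr' hpos hh hπ.1 hπ.2.1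
    refine ⟨fun θ hθ => (hPF θ hθ).1, fun θ hθ => (hPF θ hθ).2, fun θ hθ0 i => ?_⟩
    have := hM.prob i
    refine ⟨fun hθ h hh => ?_, fun hθ h hh => ?_⟩
    · have hb := fun t : ℕ => MarkovAdditive.lower_bounds_of_tail (hM.measurable_S t) hθ0
        (hM.tail_discrete hθ ((hPF θ hθ).2 h hh) hh.1 i t)
      exact ⟨fun t => (hb t).1, fun t y ht => (hb t).2 t (Nat.cast_pos.2 ht) y⟩
    -- The tail bound at parameter -θ controls small values of S(t).
    · have hb := fun t : ℕ => MarkovAdditive.upper_bounds_of_tail hθ0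
        (hM.tail_discrete hθ ((hPF (-θ) hθ).2 h hh) hh.1 i t)
      exact ⟨fun t => (hb t).1, fun t y ht => (hb t).2 t (Nat.cast_pos.2 ht) y⟩
  · have hPF : ∀ θ ∈ D.domain, (∃! h, D.IsH π θ h) ∧ ∀ h, D.IsH π θ h → ∀ j, 0 < h j :=
      fun θ hθ => by
        obtain ⟨hirr', h, hpos, hh⟩ := D.exists_pos_eigenvector_K hirr hθ
        exact MarkovAdditive.isRightEigenvector_existsUnique_pos
          (fun i j => D.K_nonneg θ) hirr' hpos hh hπ.1 hπ.2.1
    refine ⟨fun θ hθ => (hPF θ hθ).1, fun θ hθ => (hPF θ hθ).2, fun θ hθ0 i => ?_⟩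
    have := hM.isMAP.prob i
    refine ⟨fun hθ h hh => ?_, fun hθ h hh => ?_⟩
    · have hb := fun t : NNReal => MarkovAdditive.lower_bounds_of_tail
        (hM.isMAP.measurable_S t) hθ0 (hM.tail hθ ((hPF θ hθ).2 h hh) hh.1 i t)
      exact ⟨fun t => (hb t).1, fun t y ht => (hb t).2 t (NNReal.coe_pos.2 ht) y⟩
    · have hb := fun t : NNReal => MarkovAdditive.upper_bounds_of_tail hθ0
        (hM.tail hθ ((hPF (-θ) hθ).2 h hh) hh.1 i t)
      exact ⟨fun t => (hb t).1, fun t y ht => (hb t).2 t (NNReal.coe_pos.2 ht) y⟩
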